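/- Let $\mathcal H$ be a separable complex Hilbert space with an orthogonal decomposition $\mathcal H=\mathcal H_+\oplus\mathcal H_-$ into infinite-dimensional closed subspaces, let $P_+$ be the orthogonal projector onto $\mathcal H_+$, and write $L^2(E,F)$ for the Hilbert--Schmidt operators $E\to F$ with the Hilbert--Schmidt norm. For a closed subspace $W$ let $P_W$ be the orthogonal projector onto it; closed subspaces are identified with their projectors. The restricted Grassmannian $\mathrm{Gr}_{\rm res}$ is the set of closed subspaces $W\subset\mathcal H$ for which the orthogonal projection $W\to\mathcal H_+$ is Fredholm and the orthogonal projection $W\to\mathcal H_-$ is Hilbert--Schmidt. Its charts are, for $W\in\mathrm{Gr}_{\rm res}$, $$\phi_W(V)=P_{W^\perp}(P_W|_V)^{-1}\in L^2(W,W^\perp),\qquad V\in\mathrm{Gr}_{\rm res},\quad V\oplus W^\perp=\mathcal H .$$ Let $U_{\rm res}$ be the group of unitary operators $g$ on $\mathcal H$ with $[g,P_+]\in L^2(\mathcal H,\mathcal H)$, a submanifold of the algebra of bounded operators $X$ with $[X,P_+]\in L^2(\mathcal H,\mathcal H)$, normed by $\max(\|X\|,\|[X,P_+]\|_2)$. Let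 $U_+$ be the unitary group of $\mathcal H_+$ with the operator norm and $\mathfrak u_+$ the real Banach space of skew-adjoint bounded operators on $\mathcal H_+$. Let $\mathfrak U_{\rm res}$ be the groupoid over $\mathrm{Gr}_{\rm res}$ of all partial isometries $u$ of $\mathcal H$ with $u^*u,\,uu^*\in\mathrm{Gr}_{\rm res}$, with source $s(u)=u^*u$ and target $t(u)=uu^*$. Its charts are $$\Phi_{\alpha\beta\gamma}(u)=\bigl(\phi_{W_\gamma}(uu^*),\ \phi_{W_\beta}(u^*u),\ \psi_\alpha(\sigma_\gamma(uu^*)^{-1}\,u\,\sigma_\beta(u^*u)|_{\mathcal H_+})\bigr)\in L^2(W_\gamma,W_\gamma^\perp)\times L^2(W_\beta,W_\beta^\perp)\times\mathfrak u_+,$$ where $\psi_\alpha:V_\alpha\to\mathfrak u_+$ is a smooth chart of $U_+$, and $\sigma_\beta:\Omega_\beta\to U_{\rm res}$, $\sigma_\gamma:\Omega_\gamma\to U_{\rm res}$ are smooth maps with $\sigma(V)\mathcal H_+=V$ on open sets $\Omega_\beta\ni W_\beta$, $\Omega_\gamma\ni W_\gamma$ contained in the domains of $\phi_{W_\beta}$,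 $\phi_{W_\gamma}$; the domain of $\Phi_{\alpha\beta\gamma}$ is the set of $u\in\mathfrak U_{\rm res}$ with $u^*u\in\Omega_\beta$, $uu^*\in\Omega_\gamma$ and $\sigma_\gamma(uu^*)^{-1}u\,\sigma_\beta(u^*u)|_{\mathcal H_+}\in V_\alpha$. Then the groupoid $\mathfrak U_{\rm res}$ is transitive and pure: 1. (Transitive) The map $(s,t):\mathfrak U_{\rm res}\to\mathrm{Gr}_{\rm res}\times\mathrm{Gr}_{\rm res}$ is surjective. 2. (Pure base) The maps $\phi_W$ are well defined, i.e. take Hilbert--Schmidt values, and form a smooth atlas making $\mathrm{Gr}_{\rm res}$ a smooth Hausdorff Banach manifold; for every $W\in\mathrm{Gr}_{\rm res}$ the model space $L^2(W,W^\perp)$ is isomorphic, as a complex Banach space, to $L^2(\mathcal H_+,\mathcal H_-)$. 3. (Pure total space) The maps $\Phi_{\alpha\beta\gamma}$, over all choices of $\psi_\alpha,\sigma_\beta,\sigma_\gamma$ as above, form a smooth atlas making $\mathfrak U_{\rm res}$ a smooth Hausdorff Banach manifold; each of the model spaces $L^2(W_\gamma,W_\gamma^\perp)\times L^2(W_\beta,W_\beta^\perp)\times\mathfrak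 u_+$ is isomorphic, as a real Banach space, to $L^2(\mathcal H_+,\mathcal H_-)\times L^2(\mathcal H_+,\mathcal H_-)\times\mathfrak u_+$. -/

import Mathlib

open scoped ENNReal ContDiff

noncomputable section

/-! ### Hilbert-Schmidt operators -/

section HilbertSchmidt

variable (E F : Type*) [NormedAddCommGroup E] [InnerProductSpace ℂ E] [CompleteSpace E]
  [NormedAddCommGroup F] [InnerProductSpace ℂ F] [CompleteSpace F]

/-- The index set of a fixed Hilbert basis of `E`. -/
def hsIndex : Set E := (exists_hilbertBasis ℂ E).choose

/-- A fixed Hilbert basis of `E`. -/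
def hsBasis : HilbertBasis (hsIndex E) ℂ E := (exists_hilbertBasis ℂ E).choose_spec.choose

variable {E F}

/-- `T` is Hilbert-Schmidt: `∑ ‖T eᵢ‖² < ∞` for an orthonormal basis `(eᵢ)`. The condition and the
value of the sum do not depend on the basis, see `tsum_enorm_sq_hilbertBasis`. -/
def IsHilbertSchmidt (T : E →L[ℂ] F) : Prop :=
  Summable fun i : hsIndex E => ‖T (hsBasis E i)‖ ^ 2

/-- Parseval's identity. -/
theorem tsum_enorm_inner_sq {ι : Type*} (b : HilbertBasis ι ℂ E) (x : E) :
    ∑' i, ‖inner ℂ (b i) x‖ₑ ^ 2 = ‖x‖ₑ ^ 2 := by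
  have h := b.hasSum_inner_mul_inner x x
  have h2 : HasSum (fun i => ‖inner ℂ (b i) x‖ ^ 2) (‖x‖ ^ 2) := by
    have h3 := Complex.hasSum_re h
    convert h3 using 1
    · ext i
      rw [← inner_conj_symm x (b i), ← Complex.normSq_eq_conj_mul_self, Complex.ofReal_re,
        Complex.normSq_eq_norm_sq]
    · rw [inner_self_eq_norm_sq_to_K]
      norm_cast
  have h4 := ENNReal.ofReal_tsum_of_nonneg (fun i => sq_nonneg ‖inner ℂ (b i) x‖) h2.summable
  rw [h2.tsum_eq] at h4
  simpa [ENNReal.ofReal_pow, ofReal_norm] using h4.symm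

theorem tsum_enorm_sq_adjoint {ι κ : Type*} (T : E →L[ℂ] F) (b : HilbertBasis ι ℂ E)
    (c : HilbertBasis κ ℂ F) :
    ∑' i, ‖T (b i)‖ₑ ^ 2 = ∑' j, ‖ContinuousLinearMap.adjoint T (c j)‖ₑ ^ 2 := by
  calc ∑' i, ‖T (b i)‖ₑ ^ 2 = ∑' i, ∑' j, ‖inner ℂ (c j) (T (b i))‖ₑ ^ 2 := by
        simp_rw [tsum_enorm_inner_sq c]
    _ = ∑' j, ∑' i, ‖inner ℂ (c j) (T (b i))‖ₑ ^ 2 := ENNReal.tsum_comm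
    _ = ∑' j, ∑' i, ‖inner ℂ (b i) (ContinuousLinearMap.adjoint T (c j))‖ₑ ^ 2 := by
        congr with j; congr with i
        rw [← ContinuousLinearMap.adjoint_inner_left, ← ofReal_norm, ← ofReal_norm, norm_inner_symm]
    _ = _ := by simp_rw [tsum_enorm_inner_sq b]

/-- The Hilbert-Schmidt sum does not depend on the orthonormal basis. -/
theorem tsum_enorm_sq_hilbertBasis {ι ι' : Type*} (T : E →L[ℂ] F) (b : HilbertBasis ι ℂ E)
    (b' : HilbertBasis ι' ℂ E) : ∑' i, ‖T (b i)‖ₑ ^ 2 = ∑' i, ‖T (b' i)‖ₑ ^ 2 := by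
  rw [tsum_enorm_sq_adjoint T b (hsBasis F), tsum_enorm_sq_adjoint T b' (hsBasis F)]

theorem isHilbertSchmidt_iff_memℓp (T : E →L[ℂ] F) :
    IsHilbertSchmidt T ↔ Memℓp (fun i : hsIndex E => T (hsBasis E i)) 2 := by
  rw [memℓp_gen_iff (by norm_num)]
  simp [IsHilbertSchmidt]

variable (E F)

/-- The Hilbert-Schmidt operators as a linear subspace of the bounded operators. -/
def hsSubmodule : Submodule ℂ (E →L[ℂ] F) where
  carrier := {T | IsHilbertSchmidt T}
  zero_mem' := by simp [IsHilbertSchmidt, summable_zero]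
  add_mem' := by
    intro S T hS hT
    simp only [Set.mem_ofPred_eq, isHilbertSchmidt_iff_memℓp] at *
    exact hS.add hT
  smul_mem' := by
    intro c T hT
    simp only [Set.mem_ofPred_eq, isHilbertSchmidt_iff_memℓp] at *
    exact hT.const_smul c

/-- The space `L²(E, F)` of Hilbert-Schmidt operators `E → F`, normed below by the
Hilbert-Schmidt norm. -/
def HilbertSchmidt : Type _ := hsSubmodule E F

instance : AddCommGroup (HilbertSchmidt E F) := inferInstanceAs (AddCommGroup (hsSubmodule E F))

instance : Module ℂ (HilbertSchmidt E F) := inferInstanceAs (Module ℂ (hsSubmodule E F))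

/-- The inclusion of the Hilbert-Schmidt operators into the bounded operators. -/
def HilbertSchmidt.toCLM : HilbertSchmidt E F →ₗ[ℂ] (E →L[ℂ] F) := (hsSubmodule E F).subtype

/-- The values `(T eᵢ)ᵢ` on the basis, as a square-summable family. -/
def HilbertSchmidt.coord : HilbertSchmidt E F →ₗ[ℂ] lp (fun _ : hsIndex E => F) 2 where
  toFun T := ⟨fun i => HilbertSchmidt.toCLM E F T (hsBasis E i),
    (isHilbertSchmidt_iff_memℓp _).1 T.2⟩
  map_add' _ _ := rfl
  map_smul' _ _ := rfl

theorem HilbertSchmidt.coord_injective : Function.Injective (HilbertSchmidt.coord E F) := by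
  intro S T h
  apply Subtype.ext
  have h1 : ∀ i, HilbertSchmidt.toCLM E F S (hsBasis E i) =
      HilbertSchmidt.toCLM E F T (hsBasis E i) := fun i =>
    congrFun (congrArg (fun x : lp (fun _ : hsIndex E => F) 2 => (x : hsIndex E → F)) h) i
  refine ContinuousLinearMap.ext_on (s := Set.range (hsBasis E)) ?_ ?_
  · exact Submodule.dense_iff_topologicalClosure_eq_top.2 (hsBasis E).dense_span
  · rintro _ ⟨i, rfl⟩
    exact h1 i

/-- The Hilbert-Schmidt norm `‖T‖₂ = (∑ ‖T eᵢ‖²)^(1/2)`, see `HilbertSchmidt.norm_sq_eq`. -/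
instance : NormedAddCommGroup (HilbertSchmidt E F) :=
  NormedAddCommGroup.induced _ _ (HilbertSchmidt.coord E F) (HilbertSchmidt.coord_injective E F)

instance : NormedSpace ℂ (HilbertSchmidt E F) :=
  NormedSpace.induced ℂ _ _ (HilbertSchmidt.coord E F)

variable {E F}

theorem HilbertSchmidt.norm_sq_eq (T : HilbertSchmidt E F) :
    ‖T‖ ^ 2 = ∑' i, ‖HilbertSchmidt.toCLM E F T (hsBasis E i)‖ ^ 2 := by
  have h := lp.norm_rpow_eq_tsum (p := 2) (by norm_num) (HilbertSchmidt.coord E F T)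
  simp only [ENNReal.toReal_ofNat, Real.rpow_ofNat] at h
  exact h

open Classical in
/-- A bounded operator as an element of `L²(E, F)`; the value is `0` if the operator is not
Hilbert-Schmidt. -/
def HilbertSchmidt.ofCLM (T : E →L[ℂ] F) : HilbertSchmidt E F :=
  if h : IsHilbertSchmidt T then ⟨T, h⟩ else 0

end HilbertSchmidt

/-! ### Banach manifolds with possibly varying model spaces -/

section Atlas

variable {M ι : Type*} {E : ι → Type*} [∀ i, NormedAddCommGroup (E i)] [∀ i, NormedSpace ℝ (E i)]

/-- The topology on `M` generated by charts `φ i : src i → E i`. -/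
@[reducible] def atlasTopology (src : ι → Set M) (φ : ∀ i, M → E i) : TopologicalSpace M :=
  TopologicalSpace.generateFrom {U | ∃ i, ∃ s : Set (E i), IsOpen s ∧ U = src i ∩ φ i ⁻¹' s}

/-- The charts `φ i`, defined on `src i ⊆ M` and with values in `E i`, form a smooth atlas which
makes `M` a smooth Hausdorff Banach manifold; the model space may depend on the chart. -/
structure IsBanachManifoldAtlas (src : ι → Set M) (φ : ∀ i, M → E i) : Prop where
  complete : ∀ i, CompleteSpace (E i)
  cover : ∀ x, ∃ i, x ∈ src i
  injOn : ∀ i, Set.InjOn (φ i) (src i)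
  isOpen_image : ∀ i j, IsOpen (φ i '' (src i ∩ src j))
  /-- the transition map `φ j ∘ (φ i)⁻¹` is smooth on `φ i (src i ∩ src j)` -/
  smooth_transition : ∀ i j, ∃ g : E i → E j,
    ContDiffOn ℝ ∞ g (φ i '' (src i ∩ src j)) ∧ ∀ x ∈ src i ∩ src j, g (φ i x) = φ j x
  hausdorff : @T2Space M (atlasTopology src φ)

end Atlas

/-! ### The restricted Grassmannian -/

section Grassmannian

variable {H : Type*} [NormedAddCommGroup H] [InnerProductSpace ℂ H] [CompleteSpace H]

/-- The condition for a closed subspace `W` to be in the restricted Grassmannian: the orthogonal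
projection `W → H₊` is Fredholm and the orthogonal projection `W → H₋` is Hilbert-Schmidt. Here
`H₋` is the orthogonal complement of `H₊ = Hp`. -/
def IsRestricted (Hp W : Submodule ℂ H) [CompleteSpace Hp] [CompleteSpace W] : Prop :=
  ContinuousLinearMap.IsFredholm (Hp.orthogonalProjectionOnto ∘L W.subtypeL) ∧
    IsHilbertSchmidt (Hpᗮ.orthogonalProjectionOnto ∘L W.subtypeL)

variable (Hp : Submodule ℂ H) [CompleteSpace Hp]

/-- The restricted Grassmannian; a closed subspace is identified with the orthogonal projector
onto it. -/
def ResGr : Set (H →L[ℂ] H) :=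
  {p | ∃ (W : Submodule ℂ H) (_ : CompleteSpace W), IsRestricted Hp W ∧ W.starProjection = p}

variable {Hp}

/-- The closed subspace belonging to a point of the restricted Grassmannian. -/
def ResGr.space (p : ResGr Hp) : Submodule ℂ H := LinearMap.range (p : H →L[ℂ] H).toLinearMap

instance (p : ResGr Hp) : CompleteSpace (ResGr.space p) := by
  obtain ⟨W, hW, -, h⟩ := p.2
  have : ResGr.space p = W := by
    rw [ResGr.space, ← h]
    exact W.range_starProjection
  rw [this]
  exact hW

/-- The domain of the chart centred at `W`: all `V` in the restricted Grassmannian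
with `V ⊕ W^⊥ = H`. -/
def ResGr.chartDomain (W : ResGr Hp) : Set (ResGr Hp) :=
  {V | IsCompl (ResGr.space V) (ResGr.space W)ᗮ}

/-- The bounded operator `P_{W^⊥} (P_W|_V)⁻¹ : W → W^⊥`. -/
def ResGr.chartOp (W V : ResGr Hp) : ResGr.space W →L[ℂ] (ResGr.space W)ᗮ :=
  ((ResGr.space W)ᗮ.orthogonalProjectionOnto ∘L (ResGr.space V).subtypeL) ∘L
    ContinuousLinearMap.inverse
      ((ResGr.space W).orthogonalProjectionOnto ∘L (ResGr.space V).subtypeL)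

/-- The chart `V ↦ P_{W^⊥} (P_W|_V)⁻¹ ∈ L²(W, W^⊥)` centred at `W`. -/
def ResGr.chart (W V : ResGr Hp) : HilbertSchmidt (ResGr.space W) (ResGr.space W)ᗮ :=
  HilbertSchmidt.ofCLM (ResGr.chartOp W V)

end Grassmannian

/-! ### The restricted unitary group and local sections -/

section ResUnitary

variable {H : Type*} [NormedAddCommGroup H] [InnerProductSpace ℂ H] [CompleteSpace H]
variable (Hp : Submodule ℂ H) [CompleteSpace Hp]

/-- The map `X ↦ [X, P₊]`, where `P₊` is the orthogonal projector onto `H₊`. -/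
def commProj : (H →L[ℂ] H) →ₗ[ℂ] (H →L[ℂ] H) :=
  LinearMap.mulRight ℂ Hp.starProjection - LinearMap.mulLeft ℂ Hp.starProjection

/-- The algebra of all bounded operators `X` with `[X, P₊]` Hilbert-Schmidt. -/
def ResOp : Type _ := (hsSubmodule H H).comap (commProj Hp)

instance : AddCommGroup (ResOp Hp) :=
  inferInstanceAs (AddCommGroup ((hsSubmodule H H).comap (commProj Hp)))

instance : Module ℂ (ResOp Hp) :=
  inferInstanceAs (Module ℂ ((hsSubmodule H H).comap (commProj Hp)))

/-- The inclusion into the bounded operators. -/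
def ResOp.toCLM : ResOp Hp →ₗ[ℂ] (H →L[ℂ] H) := ((hsSubmodule H H).comap (commProj Hp)).subtype

/-- The map `X ↦ (X, [X, P₊])`. -/
def ResOp.pair : ResOp Hp →ₗ[ℂ] (H →L[ℂ] H) × HilbertSchmidt H H where
  toFun X := (ResOp.toCLM Hp X, ⟨commProj Hp (ResOp.toCLM Hp X), X.2⟩)
  map_add' X Y := Prod.ext rfl (Subtype.ext (map_add (commProj Hp) X.1 Y.1))
  map_smul' c X := Prod.ext rfl (Subtype.ext (map_smul (commProj Hp) c X.1))

theorem ResOp.pair_injective : Function.Injective (ResOp.pair Hp) := fun _ _ h =>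
  Subtype.ext (congrArg Prod.fst h)

/-- The norm `max (‖X‖, ‖[X, P₊]‖₂)`, which defines the topology and the manifold structure of the
restricted unitary group as a real submanifold of `ResOp Hp`. -/
instance : NormedAddCommGroup (ResOp Hp) :=
  NormedAddCommGroup.induced _ _ (ResOp.pair Hp) (ResOp.pair_injective Hp)

instance : NormedSpace ℂ (ResOp Hp) := NormedSpace.induced ℂ _ _ (ResOp.pair Hp)

/-- The restricted unitary group: all unitary `g` with `[g, P₊]` Hilbert-Schmidt. -/
def ResUnitary : Set (ResOp Hp) := {g | ResOp.toCLM Hp g ∈ unitary (H →L[ℂ] H)}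

/-- A smooth local section `σ : Ω → U_res` of `g ↦ g H₊`, on an open set `Ω` of the restricted
Grassmannian which contains `W` and lies in the domain of the chart centred at `W`. -/
structure LocalSection where
  /-- the point `W` -/
  base : ResGr Hp
  /-- the open set `Ω` -/
  dom : Set (ResGr Hp)
  /-- the section `σ` (only its values on `Ω` matter) -/
  toFun : ResGr Hp → ResOp Hp
  base_mem : base ∈ dom
  dom_subset : dom ⊆ ResGr.chartDomain base
  isOpen_dom : IsOpen (ResGr.chart base '' dom)
  mem_resUnitary : ∀ V ∈ dom, toFun V ∈ ResUnitary Hp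
  map_eq : ∀ V ∈ dom, Hp.map (ResOp.toCLM Hp (toFun V)).toLinearMap = ResGr.space V
  /-- `σ` is smooth, read in the chart centred at `W` -/
  smooth : ∃ g : HilbertSchmidt (ResGr.space base) (ResGr.space base)ᗮ → ResOp Hp,
    ContDiffOn ℝ ∞ g (ResGr.chart base '' dom) ∧ ∀ V ∈ dom, g (ResGr.chart base V) = toFun V

end ResUnitary

/-! ### The unitary group of `H₊` -/

section UnitaryCharts

variable (K : Type*) [NormedAddCommGroup K] [InnerProductSpace ℂ K] [CompleteSpace K]

/-- The real Banach space of skew-adjoint bounded operators on `K`, with the operator norm. -/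
abbrev SkewOp : Type _ := skewAdjoint.submodule ℝ (K →L[ℂ] K)

/-- A chart of the unitary group `U(K)`, a real submanifold of the bounded operators with the
operator norm, with values in its Lie algebra. -/
structure UnitaryChart where
  /-- the domain `V` -/
  dom : Set (K →L[ℂ] K)
  /-- the chart `ψ` (only its values on `V` matter) -/
  toFun : (K →L[ℂ] K) → SkewOp K
  /-- `V` is an open subset of the unitary group -/
  isOpen_dom : ∃ O : Set (K →L[ℂ] K), IsOpen O ∧ dom = O ∩ unitary (K →L[ℂ] K)
  isOpen_image : IsOpen (toFun '' dom)
  smooth : ContDiffOn ℝ ∞ toFun dom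
  /-- `ψ` has a smooth inverse -/
  smooth_inv : ∃ g : SkewOp K → (K →L[ℂ] K),
    ContDiffOn ℝ ∞ g (toFun '' dom) ∧ ∀ u ∈ dom, g (toFun u) = u

end UnitaryCharts

/-! ### Partial isometries over the restricted Grassmannian -/

section PartialIsometries

variable {H : Type*} [NormedAddCommGroup H] [InnerProductSpace ℂ H] [CompleteSpace H]

/-- `u` is a partial isometry: `u* u` is an orthogonal projector. -/
def IsPartialIsometry (u : H →L[ℂ] H) : Prop := IsStarProjection (star u * u)

variable (Hp : Submodule ℂ H) [CompleteSpace Hp]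

/-- The groupoid of partial isometries `u` with `u* u` and `u u*` in the restricted
Grassmannian. -/
def URes : Set (H →L[ℂ] H) :=
  {u | IsPartialIsometry u ∧ star u * u ∈ ResGr Hp ∧ u * star u ∈ ResGr Hp}

variable {Hp}

/-- The source map `s(u) = u* u`. -/
def URes.source (u : URes Hp) : ResGr Hp := ⟨star u.1 * u.1, u.2.2.1⟩

/-- The target map `t(u) = u u*`. -/
def URes.target (u : URes Hp) : ResGr Hp := ⟨u.1 * star u.1, u.2.2.2⟩

variable (Hp)

/-- The indices of the charts of the groupoid: a chart of `U(H₊)`, a local section used at the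
source, and a local section used at the target. -/
structure URes.ChartIndex where
  α : UnitaryChart Hp
  β : LocalSection Hp
  γ : LocalSection Hp

variable {Hp}

/-- The operator `σ_γ(u u*)⁻¹ u σ_β(u* u)|_{H₊}` on `H₊`. -/
def URes.transport (β γ : LocalSection Hp) (u : URes Hp) : Hp →L[ℂ] Hp :=
  Hp.orthogonalProjectionOnto ∘L
    (star (ResOp.toCLM Hp (γ.toFun (URes.target u))) * u.1 * ResOp.toCLM Hp (β.toFun (URes.source u))) ∘L
    Hp.subtypeL

/-- The domain of a chart of the groupoid. -/
def URes.chartDomain (i : URes.ChartIndex Hp) : Set (URes Hp) :=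
  {u | URes.source u ∈ i.β.dom ∧ URes.target u ∈ i.γ.dom ∧ URes.transport i.β i.γ u ∈ i.α.dom}

/-- The model space `L²(W_γ, W_γ^⊥) × L²(W_β, W_β^⊥) × 𝔲₊` of a chart of the groupoid. -/
abbrev URes.Model (i : URes.ChartIndex Hp) : Type _ :=
  HilbertSchmidt (ResGr.space i.γ.base) (ResGr.space i.γ.base)ᗮ ×
    HilbertSchmidt (ResGr.space i.β.base) (ResGr.space i.β.base)ᗮ × SkewOp Hp

/-- The charts of the groupoid. -/
def URes.chart (i : URes.ChartIndex Hp) (u : URes Hp) : URes.Model i :=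
  (ResGr.chart i.γ.base (URes.target u), ResGr.chart i.β.base (URes.source u),
    i.α.toFun (URes.transport i.β i.γ u))

end PartialIsometries

end

/-! Everything rests on a symmetric description of the restricted Grassmannian: a closed subspace
`W` belongs to it exactly when `P_W - P₊` is Hilbert-Schmidt (`isRestricted_iff`, `mem_resGr_iff`).
One direction uses a parametrix of the Fredholm projection. The other holds because an operator
invertible modulo Hilbert-Schmidt operators is Fredholm, a Hilbert-Schmidt operator being of finite
rank up to a small error. Hence the projectors of any two points differ by a Hilbert-Schmidt
operator, which makes the charts Hilbert-Schmidt valued and keeps `W` and `W^⊥`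
infinite-dimensional. By separability these spaces are then isometric to `H₊` and `H₋`. This yields
the isomorphisms of model spaces, and an isometry between two points, extended by zero, is the
partial isometry needed for transitivity.

For the base, the chart at `W` identifies its domain with all of `L²(W, W^⊥)`, the inverse sending
`T` to its graph. Extend `T` by zero and put `S = T - T*`. Since `S` is skew-adjoint, `1 + S` is
invertible. It maps `W` onto the graph, and `S²` commutes with `P_W`, so `(1 + S) P_W (1 + S)⁻¹` is
the orthogonal projector onto the graph. Its difference from `P_W` is `(T + T*)(1 + S)⁻¹`, which
depends smoothly on `T` as a Hilbert-Schmidt operator. A change of charts is one block of the graph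
map times the inverse of another, with the first block taken in `L²`. It is smooth because
composition is bounded bilinear and inversion is smooth.

For the total space, the unitary polar factor `(1 + S)(1 - S²)^(-1/2)` rotates `W` onto nearby
points. Composed with a fixed unitary taking `H₊` to `W`, it gives a local section `σ`. Smoothness
in the norm of `U_res` follows from `[σ, P₊] = (P_V - P₊) σ`. Cayley transforms supply charts of
`U(H₊)`. The formula `u = σ_γ τ σ_β*`, with `τ` unitary on `H₊`, then inverts the groupoid charts
and expresses their transitions by smooth operations. Both manifolds are Hausdorff because they
inject into the bounded operators continuously in every chart. -/

set_option linter.unusedSectionVars false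

noncomputable section

/-! ### Hilbert-Schmidt operators: ideal property, norm comparison, finite-rank approximation. -/

section HSOperators

variable {E F G : Type*} [NormedAddCommGroup E] [InnerProductSpace ℂ E] [CompleteSpace E]
  [NormedAddCommGroup F] [InnerProductSpace ℂ F] [CompleteSpace F]
  [NormedAddCommGroup G] [InnerProductSpace ℂ G] [CompleteSpace G]

/-- Sums in `ℝ≥0∞` can be compared and interchanged without separate summability proofs. -/
theorem isHilbertSchmidt_iff_tsum_ne_top (T : E →L[ℂ] F) :
    IsHilbertSchmidt T ↔ ∑' i, ‖T (hsBasis E i)‖ₑ ^ 2 ≠ ⊤ := by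
  have h : (fun i => ‖T (hsBasis E i)‖ₑ ^ 2) =
      fun i => ENNReal.ofReal (‖T (hsBasis E i)‖ ^ 2) := by
    ext i
    rw [ENNReal.ofReal_pow (norm_nonneg _), ofReal_norm]
  rw [h, IsHilbertSchmidt]
  constructor
  · intro hs
    exact hs.tsum_ofReal_ne_top
  · intro hs
    have := ENNReal.summable_toReal hs
    simpa [ENNReal.toReal_ofReal, sq_nonneg] using this

theorem IsHilbertSchmidt.adjoint {T : E →L[ℂ] F} (hT : IsHilbertSchmidt T) :
    IsHilbertSchmidt (ContinuousLinearMap.adjoint T) := by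
  rw [isHilbertSchmidt_iff_tsum_ne_top] at hT ⊢
  rwa [← tsum_enorm_sq_adjoint T (hsBasis E) (hsBasis F)]

theorem tsum_enorm_sq_comp_le (A : F →L[ℂ] G) (T : E →L[ℂ] F) :
    ∑' i, ‖(A ∘L T) (hsBasis E i)‖ₑ ^ 2 ≤ ‖A‖ₑ ^ 2 * ∑' i, ‖T (hsBasis E i)‖ₑ ^ 2 := by
  rw [← ENNReal.tsum_mul_left]
  refine ENNReal.tsum_le_tsum fun i => ?_
  rw [← mul_pow]
  exact pow_le_pow_left' (A.le_opENorm _) 2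

theorem IsHilbertSchmidt.comp_left {T : E →L[ℂ] F} (hT : IsHilbertSchmidt T) (A : F →L[ℂ] G) :
    IsHilbertSchmidt (A ∘L T) := by
  rw [isHilbertSchmidt_iff_tsum_ne_top] at hT ⊢
  refine ne_top_of_le_ne_top ?_ (tsum_enorm_sq_comp_le A T)
  exact ENNReal.mul_ne_top (by simp) hT

/-- Taking adjoints turns right composition into left composition. -/
theorem IsHilbertSchmidt.comp_right {T : F →L[ℂ] G} (hT : IsHilbertSchmidt T) (A : E →L[ℂ] F) :
    IsHilbertSchmidt (T ∘L A) := by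
  have h := (hT.adjoint.comp_left (ContinuousLinearMap.adjoint A)).adjoint
  rwa [← ContinuousLinearMap.adjoint_comp, ContinuousLinearMap.adjoint_adjoint] at h

theorem IsHilbertSchmidt.add {S T : E →L[ℂ] F} (hS : IsHilbertSchmidt S)
    (hT : IsHilbertSchmidt T) : IsHilbertSchmidt (S + T) :=
  (hsSubmodule E F).add_mem hS hT

theorem IsHilbertSchmidt.neg {S : E →L[ℂ] F} (hS : IsHilbertSchmidt S) :
    IsHilbertSchmidt (-S) :=
  (hsSubmodule E F).neg_mem hS

theorem IsHilbertSchmidt.sub {S T : E →L[ℂ] F} (hS : IsHilbertSchmidt S)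
    (hT : IsHilbertSchmidt T) : IsHilbertSchmidt (S - T) :=
  (hsSubmodule E F).sub_mem hS hT

theorem finite_hsIndex [FiniteDimensional ℂ E] : Finite (hsIndex E) :=
  (hsBasis E).orthonormal.linearIndependent.finite

/-- The span of the basis is dense, and being finite-dimensional it is closed, hence everything. -/
theorem finiteDimensional_of_finite_hsIndex [Finite (hsIndex E)] : FiniteDimensional ℂ E := by
  have h := (hsBasis E).dense_span
  have hf : FiniteDimensional ℂ (Submodule.span ℂ (Set.range (hsBasis E))) :=
    FiniteDimensional.span_of_finite ℂ (Set.finite_range _)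
  rw [(Submodule.closed_of_finiteDimensional _).submodule_topologicalClosure_eq] at h
  rw [h] at hf
  exact Module.finite_def.2 (Submodule.fg_top _ |>.1 (Module.finite_def.1 hf))

theorem isHilbertSchmidt_of_finiteDimensional_dom [FiniteDimensional ℂ E] (T : E →L[ℂ] F) :
    IsHilbertSchmidt T := by
  have := finite_hsIndex (E := E)
  exact Summable.of_finite

theorem isHilbertSchmidt_of_finiteDimensional_codom [FiniteDimensional ℂ F] (T : E →L[ℂ] F) :
    IsHilbertSchmidt T := by
  have h := (isHilbertSchmidt_of_finiteDimensional_dom (ContinuousLinearMap.adjoint T)).adjoint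
  rwa [ContinuousLinearMap.adjoint_adjoint] at h

theorem isHilbertSchmidt_of_hasFiniteRange {T : E →L[ℂ] F}
    (hT : T.toLinearMap.HasFiniteRange) : IsHilbertSchmidt T := by
  have hf : FiniteDimensional ℂ T.range := Module.Finite.of_fg hT
  have h1 : IsHilbertSchmidt (T.codRestrict T.range fun x => ⟨x, rfl⟩) :=
    isHilbertSchmidt_of_finiteDimensional_codom _
  exact h1.comp_left T.range.subtypeL

/-- The identity is Hilbert-Schmidt only in finite dimension. -/
theorem finiteDimensional_of_isHilbertSchmidt_id
    (h : IsHilbertSchmidt (ContinuousLinearMap.id ℂ E)) : FiniteDimensional ℂ E := by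
  have h1 : Summable fun _ : hsIndex E => (1 : ℝ) := by
    simpa [IsHilbertSchmidt, (hsBasis E).orthonormal.1] using h
  have : Finite (hsIndex E) := by
    by_contra hi
    rw [not_finite_iff_infinite] at hi
    rw [summable_const_iff] at h1
    exact one_ne_zero h1
  exact finiteDimensional_of_finite_hsIndex

/-- Parseval for `T* y` in the basis of `E`, then Cauchy-Schwarz in each coordinate `⟨T eᵢ, y⟩`. -/
theorem enorm_sq_adjoint_apply_le (T : E →L[ℂ] F) (y : F) :
    ‖ContinuousLinearMap.adjoint T y‖ₑ ^ 2 ≤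
      (∑' i, ‖T (hsBasis E i)‖ₑ ^ 2) * ‖y‖ₑ ^ 2 := by
  rw [← tsum_enorm_inner_sq (hsBasis E), ← ENNReal.tsum_mul_right]
  refine ENNReal.tsum_le_tsum fun i => ?_
  rw [ContinuousLinearMap.adjoint_inner_right, ← mul_pow]
  refine pow_le_pow_left' ?_ 2
  rw [← ofReal_norm, ← ofReal_norm, ← ofReal_norm, ← ENNReal.ofReal_mul (norm_nonneg _)]
  exact ENNReal.ofReal_le_ofReal (norm_inner_le_norm _ _)

/-- The operator norm is bounded by the Hilbert-Schmidt norm. -/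
theorem enorm_sq_le_tsum (T : E →L[ℂ] F) :
    ‖T‖ₑ ^ 2 ≤ ∑' i, ‖T (hsBasis E i)‖ₑ ^ 2 := by
  by_cases htop : ∑' i, ‖T (hsBasis E i)‖ₑ ^ 2 = ⊤
  · rw [htop]; exact le_top
  set S := ∑' i, ‖T (hsBasis E i)‖ₑ ^ 2 with hS
  have h1 : ‖ContinuousLinearMap.adjoint T‖ ≤ Real.sqrt S.toReal := by
    refine ContinuousLinearMap.opNorm_le_bound _ (Real.sqrt_nonneg _) fun y => ?_
    have h := enorm_sq_adjoint_apply_le T y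
    rw [← hS] at h
    have h2 := ENNReal.toReal_mono (ENNReal.mul_ne_top htop (by simp)) h
    simp only [ENNReal.toReal_pow, ENNReal.toReal_mul, toReal_enorm] at h2
    refine le_of_sq_le_sq ?_ (by positivity)
    rw [mul_pow, Real.sq_sqrt ENNReal.toReal_nonneg]
    exact h2
  rw [LinearIsometryEquiv.norm_map] at h1
  have h3 : ‖T‖ ^ 2 ≤ S.toReal := by
    have := pow_le_pow_left₀ (norm_nonneg _) h1 2
    rwa [Real.sq_sqrt ENNReal.toReal_nonneg] at this
  rw [← ofReal_norm, ← ENNReal.ofReal_pow (norm_nonneg _)]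
  exact ENNReal.ofReal_le_of_le_toReal h3

/-- A Hilbert-Schmidt operator is a finite rank operator up to a small operator. -/
theorem IsHilbertSchmidt.exists_hasFiniteRange {T : E →L[ℂ] F} (hT : IsHilbertSchmidt T)
    {ε : ℝ} (hε : 0 < ε) : ∃ R : E →L[ℂ] F, R.toLinearMap.HasFiniteRange ∧ ‖T - R‖ < ε := by
  classical
  rw [isHilbertSchmidt_iff_tsum_ne_top] at hT
  have hlim := ENNReal.tendsto_tsum_compl_atTop_zero hT
  have hε2 : (0 : ℝ≥0∞) < ENNReal.ofReal (ε ^ 2) := by positivity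
  obtain ⟨s, hs⟩ := (hlim.eventually_lt_const hε2).exists
  -- `R` agrees with `T` on the basis vectors in `s` and kills the others, so the Hilbert-Schmidt
  -- sum of `T - R` is the tail of that of `T`.
  let R : E →L[ℂ] F := ∑ i ∈ s, (innerSL ℂ (hsBasis E i)).smulRight (T (hsBasis E i))
  have hR : ∀ x, R x = ∑ i ∈ s, inner ℂ (hsBasis E i) x • T (hsBasis E i) := by
    intro x
    simp [R]
  refine ⟨R, ?_, ?_⟩
  · have : R.toLinearMap.range ≤ Submodule.span ℂ ((fun i => T (hsBasis E i)) '' (s : Set _)) := by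
      rintro _ ⟨x, rfl⟩
      change R x ∈ _
      rw [hR]
      refine Submodule.sum_mem _ fun i hi => Submodule.smul_mem _ _ (Submodule.subset_span ?_)
      exact ⟨i, hi, rfl⟩
    have hfd : FiniteDimensional ℂ
        (Submodule.span ℂ ((fun i => T (hsBasis E i)) '' (s : Set (hsIndex E)))) :=
      FiniteDimensional.span_of_finite ℂ (s.finite_toSet.image _)
    have := Submodule.finiteDimensional_of_le this
    exact Module.Finite.iff_fg.1 this
  · have hval : ∀ i, (T - R) (hsBasis E i) = if i ∈ s then 0 else T (hsBasis E i) := by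
      intro i
      have ho := orthonormal_iff_ite.1 (hsBasis E).orthonormal
      rw [sub_apply, hR]
      simp only [ho, ite_smul, one_smul, zero_smul, Finset.sum_ite_eq']
      split_ifs <;> simp
    have h1 : ∑' i, ‖(T - R) (hsBasis E i)‖ₑ ^ 2 =
        ∑' i : {x // x ∉ s}, ‖T (hsBasis E i)‖ₑ ^ 2 := by
      have := tsum_subtype (({x | x ∉ s} : Set (hsIndex E))) (fun i => ‖T (hsBasis E i)‖ₑ ^ 2)
      refine Eq.trans ?_ this.symm
      congr with i
      rw [hval]
      by_cases hi : i ∈ s <;> simp [hi]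
    have h2 := (enorm_sq_le_tsum (T - R)).trans_lt (h1 ▸ hs)
    rw [← ofReal_norm, ← ENNReal.ofReal_pow (norm_nonneg _)] at h2
    exact lt_of_pow_lt_pow_left₀ 2 hε.le ((ENNReal.ofReal_lt_ofReal_iff (by positivity)).1 h2)

end HSOperators

/-! ### The Banach space of Hilbert-Schmidt operators -/

namespace HilbertSchmidt

variable {E F G : Type*} [NormedAddCommGroup E] [InnerProductSpace ℂ E] [CompleteSpace E]
  [NormedAddCommGroup F] [InnerProductSpace ℂ F] [CompleteSpace F]
  [NormedAddCommGroup G] [InnerProductSpace ℂ G] [CompleteSpace G]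

/-- A bounded operator that is Hilbert-Schmidt, as an element of `L²(E, F)`. -/
def mk (T : E →L[ℂ] F) (hT : IsHilbertSchmidt T) : HilbertSchmidt E F := ⟨T, hT⟩

@[simp]
theorem toCLM_mk (T : E →L[ℂ] F) (hT : IsHilbertSchmidt T) : toCLM E F (mk T hT) = T := rfl

theorem toCLM_injective : Function.Injective (toCLM E F) := Subtype.val_injective

theorem isHilbertSchmidt (T : HilbertSchmidt E F) : IsHilbertSchmidt (toCLM E F T) := T.2

theorem toCLM_ofCLM {T : E →L[ℂ] F} (hT : IsHilbertSchmidt T) : toCLM E F (ofCLM T) = T := by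
  have h : ofCLM T = mk T hT := dif_pos hT
  rw [h, toCLM_mk]

theorem enorm_sq_eq (T : HilbertSchmidt E F) :
    ‖T‖ₑ ^ 2 = ∑' i, ‖toCLM E F T (hsBasis E i)‖ₑ ^ 2 := by
  rw [← ofReal_norm, ← ENNReal.ofReal_pow (norm_nonneg _), norm_sq_eq,
    ENNReal.ofReal_tsum_of_nonneg (fun _ => by positivity) T.isHilbertSchmidt]
  congr with i
  rw [ENNReal.ofReal_pow (norm_nonneg _), ofReal_norm]

theorem norm_le_of_enorm_sq_le {X Y : Type*} [SeminormedAddCommGroup X] [SeminormedAddCommGroup Y]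
    {x : X} {y : Y} (h : ‖x‖ₑ ^ 2 ≤ ‖y‖ₑ ^ 2) : ‖x‖ ≤ ‖y‖ := by
  have h1 : ‖x‖ₑ ≤ ‖y‖ₑ := by
    by_contra hc
    exact absurd h (not_le.2 (ENNReal.pow_lt_pow_left two_ne_zero (not_le.1 hc)))
  rw [← ofReal_norm, ← ofReal_norm] at h1
  exact (ENNReal.ofReal_le_ofReal_iff (norm_nonneg _)).1 h1

theorem norm_toCLM_le (T : HilbertSchmidt E F) : ‖toCLM E F T‖ ≤ ‖T‖ := by
  apply norm_le_of_enorm_sq_le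
  rw [enorm_sq_eq]
  exact enorm_sq_le_tsum _

variable (E F) in
/-- The inclusion into the bounded operators as a bounded map. -/
def toCLML : HilbertSchmidt E F →L[ℂ] (E →L[ℂ] F) :=
  (toCLM E F).mkContinuous 1 fun T => by simpa using norm_toCLM_le T

@[simp]
theorem toCLML_apply (T : HilbertSchmidt E F) : toCLML E F T = toCLM E F T := rfl

theorem norm_mk_comp_le (A : F →L[ℂ] G) (T : HilbertSchmidt E F) :
    ‖mk (A ∘L toCLM E F T) (T.isHilbertSchmidt.comp_left A)‖ ≤ ‖A‖ * ‖T‖ := by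
  have h := tsum_enorm_sq_comp_le A (toCLM E F T)
  rw [← enorm_sq_eq T, ← mul_pow] at h
  have h1 : ‖mk (A ∘L toCLM E F T) (T.isHilbertSchmidt.comp_left A)‖ₑ ^ 2 ≤
      ‖‖A‖ * ‖T‖‖ₑ ^ 2 := by
    rw [enorm_sq_eq]
    refine h.trans (le_of_eq ?_)
    rw [enorm_mul, enorm_norm, enorm_norm]
  refine (norm_le_of_enorm_sq_le h1).trans (le_of_eq ?_)
  simp

/-- The adjoint, as a real-linear isometry. -/
def adjointL : HilbertSchmidt E F →L[ℝ] HilbertSchmidt F E :=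
  LinearMap.mkContinuous
    { toFun := fun T => mk (ContinuousLinearMap.adjoint (toCLM E F T)) T.isHilbertSchmidt.adjoint
      map_add' := fun S T => toCLM_injective (by simp)
      map_smul' := fun c T => toCLM_injective (by
        have h : toCLM E F (c • T) = (c : ℂ) • toCLM E F T := (toCLM E F).map_smul (c : ℂ) T
        have h2 : ∀ S : HilbertSchmidt F E, toCLM F E (c • S) = (c : ℂ) • toCLM F E S :=
          fun S => (toCLM F E).map_smul (c : ℂ) S
        simp only [RingHom.id_apply, h2, toCLM_mk, h, map_smulₛₗ, Complex.conj_ofReal]) } 1 fun T => by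
    rw [one_mul]
    apply norm_le_of_enorm_sq_le
    rw [enorm_sq_eq, enorm_sq_eq T, tsum_enorm_sq_adjoint _ (hsBasis E) (hsBasis F)]
    rfl

@[simp]
theorem toCLM_adjointL (T : HilbertSchmidt E F) :
    toCLM F E (adjointL T) = ContinuousLinearMap.adjoint (toCLM E F T) := rfl

theorem norm_adjointL_le (T : HilbertSchmidt E F) : ‖adjointL T‖ ≤ ‖T‖ := by
  apply norm_le_of_enorm_sq_le
  rw [enorm_sq_eq, enorm_sq_eq T, tsum_enorm_sq_adjoint _ (hsBasis E) (hsBasis F)]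
  rfl

/-- Composition with a bounded operator on the left, as a bounded bilinear map. -/
def compLeft : (F →L[ℂ] G) →L[ℂ] HilbertSchmidt E F →L[ℂ] HilbertSchmidt E G :=
  LinearMap.mkContinuous₂
    (LinearMap.mk₂ ℂ (fun A T => mk (A ∘L toCLM E F T) (T.isHilbertSchmidt.comp_left A))
      (fun _ _ _ => toCLM_injective (by simp)) (fun _ _ _ => toCLM_injective (by simp))
      (fun _ _ _ => toCLM_injective (by simp)) (fun _ _ _ => toCLM_injective (by simp)))
    1 fun A T => by
      rw [one_mul]
      exact norm_mk_comp_le A T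

@[simp]
theorem toCLM_compLeft (A : F →L[ℂ] G) (T : HilbertSchmidt E F) :
    toCLM E G (compLeft A T) = A ∘L toCLM E F T := rfl

/-- Composition with a bounded operator on the right, as a bounded bilinear map. -/
def compRight : HilbertSchmidt F G →L[ℂ] (E →L[ℂ] F) →L[ℂ] HilbertSchmidt E G :=
  LinearMap.mkContinuous₂
    (LinearMap.mk₂ ℂ (fun T A => mk (toCLM F G T ∘L A) (T.isHilbertSchmidt.comp_right A))
      (fun _ _ _ => toCLM_injective (by simp)) (fun _ _ _ => toCLM_injective (by simp))
      (fun _ _ _ => toCLM_injective (by simp)) (fun _ _ _ => toCLM_injective (by simp)))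
    1 fun T A => by
      rw [one_mul]
      -- The adjoint does not increase the Hilbert-Schmidt norm, so the bound reduces to left
      -- composition.
      have h : mk (toCLM F G T ∘L A) (T.isHilbertSchmidt.comp_right A) =
          adjointL (mk (ContinuousLinearMap.adjoint A ∘L toCLM G F (adjointL T))
            ((adjointL T).isHilbertSchmidt.comp_left _)) :=
        toCLM_injective (by simp [ContinuousLinearMap.adjoint_comp])
      change ‖mk (toCLM F G T ∘L A) (T.isHilbertSchmidt.comp_right A)‖ ≤ _
      rw [h]
      refine (norm_adjointL_le _).trans ((norm_mk_comp_le _ _).trans ?_)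
      rw [LinearIsometryEquiv.norm_map, mul_comm]
      exact mul_le_mul_of_nonneg_right (norm_adjointL_le T) (norm_nonneg A)

@[simp]
theorem toCLM_compRight (T : HilbertSchmidt F G) (A : E →L[ℂ] F) :
    toCLM E G (compRight T A) = toCLM F G T ∘L A := rfl

/-- A Cauchy sequence converges both in operator norm and, through its coordinates, in `ℓ²`. The two
limits agree on the basis, so the operator limit is Hilbert-Schmidt and is the limit in `L²`. -/
instance : CompleteSpace (HilbertSchmidt E F) := by
  refine Metric.complete_of_cauchySeq_tendsto fun u hu => ?_
  have hiso : Isometry (coord E F) :=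
    AddMonoidHomClass.isometry_of_norm (coord E F) fun _ => rfl
  obtain ⟨f, hf⟩ := cauchySeq_tendsto_of_complete (hiso.uniformContinuous.comp_cauchySeq hu)
  obtain ⟨T, hT⟩ := cauchySeq_tendsto_of_complete
    ((toCLML E F).uniformContinuous.comp_cauchySeq hu)
  have hval : ∀ i, T (hsBasis E i) = f i := by
    intro i
    have h1 : Filter.Tendsto (fun n => toCLM E F (u n) (hsBasis E i)) Filter.atTop
        (nhds (T (hsBasis E i))) :=
      ((ContinuousLinearMap.apply ℂ F (hsBasis E i)).continuous.tendsto T).comp hT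
    have h2 : Filter.Tendsto (fun n => (coord E F (u n) : hsIndex E → F) i) Filter.atTop
        (nhds (f i)) := by
      have := (lp.uniformContinuous_coe (E := fun _ : hsIndex E => F) (p := 2)).continuous.tendsto f
      exact (tendsto_pi_nhds.1 (this.comp hf)) i
    exact tendsto_nhds_unique h1 h2
  have hHS : IsHilbertSchmidt T := by
    rw [isHilbertSchmidt_iff_memℓp]
    simp_rw [hval]
    exact f.2
  have hc : coord E F (mk T hHS) = f := by
    apply Subtype.ext
    funext i
    exact hval i
  refine ⟨mk T hHS, ?_⟩
  rw [hiso.isEmbedding.isInducing.tendsto_nhds_iff, hc]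
  exact hf

end HilbertSchmidt

/-! ### Fredholmness from invertibility modulo Hilbert-Schmidt operators. -/

section Fredholm

variable {E F : Type*} [NormedAddCommGroup E] [InnerProductSpace ℂ E] [CompleteSpace E]
  [NormedAddCommGroup F] [InnerProductSpace ℂ F] [CompleteSpace F]

/-- A Hilbert-Schmidt perturbation of the identity is invertible up to finite rank. -/
theorem IsHilbertSchmidt.exists_quasiInverse_one_add {K : E →L[ℂ] E} (hK : IsHilbertSchmidt K) :
    ∃ R : E →L[ℂ] E, (R * (1 + K) - 1).toLinearMap.HasFiniteRange ∧
      ((1 + K) * R - 1).toLinearMap.HasFiniteRange := by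
  -- Once a finite-rank part `N` is split off, the Neumann series inverts the rest; that inverse is
  -- the parametrix.
  obtain ⟨N, hN, hsmall⟩ := hK.exists_hasFiniteRange one_pos
  have hu : IsUnit (1 + (K - N)) := by
    have := isUnit_one_sub_of_norm_lt_one (x := -(K - N)) (by rwa [norm_neg])
    rwa [sub_neg_eq_add] at this
  obtain ⟨u, hu⟩ := hu
  have h1 : 1 + K = u + N := by rw [hu]; abel
  refine ⟨↑u⁻¹, ?_, ?_⟩
  · have : (↑u⁻¹ : E →L[ℂ] E) * (1 + K) - 1 = ↑u⁻¹ * N := by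
      rw [h1, mul_add, Units.inv_mul]; abel
    rw [this]
    exact hN.comp_left _
  · have : (1 + K) * (↑u⁻¹ : E →L[ℂ] E) - 1 = N * ↑u⁻¹ := by
      rw [h1, add_mul, Units.mul_inv]; abel
    rw [this]
    exact hN.comp_right _

open scoped LinearMap.FiniteRangeSetoid in
/-- An operator that is invertible up to Hilbert-Schmidt operators is Fredholm. -/
theorem isFredholm_of_isHilbertSchmidt {A : E →L[ℂ] F} {B : F →L[ℂ] E}
    (h1 : IsHilbertSchmidt (B ∘L A - ContinuousLinearMap.id ℂ E))
    (h2 : IsHilbertSchmidt (A ∘L B - ContinuousLinearMap.id ℂ F)) : A.IsFredholm := by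
  obtain ⟨R, hR, -⟩ := h1.exists_quasiInverse_one_add
  obtain ⟨S, -, hS⟩ := h2.exists_quasiInverse_one_add
  have e1 : (1 : E →L[ℂ] E) + (B ∘L A - ContinuousLinearMap.id ℂ E) = B ∘L A :=
    add_sub_cancel _ _
  have e2 : (1 : F →L[ℂ] F) + (A ∘L B - ContinuousLinearMap.id ℂ F) = A ∘L B :=
    add_sub_cancel _ _
  rw [e1] at hR
  rw [e2] at hS
  have hL : (R ∘L B ∘L A).toLinearMap ≈ LinearMap.id :=
    LinearMap.FiniteRangeSetoid.equiv_iff_hasFiniteRange.2 hR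
  have hr : (A ∘L B ∘L S).toLinearMap ≈ LinearMap.id :=
    LinearMap.FiniteRangeSetoid.equiv_iff_hasFiniteRange.2 hS
  -- Modulo finite rank `R B` is a left inverse of `A` and `B S` a right inverse, so they coincide
  -- by the usual associativity argument.
  have hLR : (B ∘L S).toLinearMap ≈ (R ∘L B).toLinearMap := by
    have ha : (R ∘L B ∘L A).toLinearMap ∘ₗ (B ∘L S).toLinearMap ≈
        LinearMap.id ∘ₗ (B ∘L S).toLinearMap :=
      LinearMap.FiniteRangeSetoid.equiv_comp_right hL
    have hb : (R ∘L B).toLinearMap ∘ₗ (A ∘L B ∘L S).toLinearMap ≈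
        (R ∘L B).toLinearMap ∘ₗ LinearMap.id :=
      LinearMap.FiniteRangeSetoid.equiv_comp_left hr
    exact Setoid.trans (Setoid.symm ha) hb
  refine ContinuousLinearMap.IsFredholm.of_isQuasiInverse (v := B ∘L S) ⟨?_, hr⟩
  have hc : (B ∘L S).toLinearMap ∘ₗ A.toLinearMap ≈ (R ∘L B).toLinearMap ∘ₗ A.toLinearMap :=
    LinearMap.FiniteRangeSetoid.equiv_comp_right hLR
  exact Setoid.trans hc hL

end Fredholm

/-! ### Isometries between separable infinite-dimensional Hilbert spaces. -/

section SeparableHilbert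

variable {E F : Type*} [NormedAddCommGroup E] [InnerProductSpace ℂ E] [CompleteSpace E]
  [NormedAddCommGroup F] [InnerProductSpace ℂ F] [CompleteSpace F]

/-- Distinct members are at distance `√2`, so the balls of radius `1/2` around them are disjoint
open sets. -/
theorem Orthonormal.countable {ι : Type*} [TopologicalSpace.SeparableSpace E] {v : ι → E}
    (hv : Orthonormal ℂ v) : Countable ι := by
  have hd : Set.PairwiseDisjoint (Set.univ : Set ι) fun i => Metric.ball (v i) (1 / 2) := by
    intro i _ j _ hij
    refine Metric.ball_disjoint_ball ?_
    have h : ‖v i - v j‖ ^ 2 = 2 := by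
      have := norm_sub_sq (𝕜 := ℂ) (v i) (v j)
      rw [this, hv.2 hij, hv.1, hv.1]
      norm_num
    rw [dist_eq_norm]
    nlinarith [norm_nonneg (v i - v j)]
  have := hd.countable_of_isOpen (fun _ _ => Metric.isOpen_ball)
    (fun i _ => Metric.nonempty_ball.2 (by norm_num))
  exact Set.countable_univ_iff.1 this

theorem nonempty_hilbertBasis_nat [TopologicalSpace.SeparableSpace E]
    (hE : ¬ FiniteDimensional ℂ E) : Nonempty (HilbertBasis ℕ ℂ E) := by
  have hc : Countable (hsIndex E) := (hsBasis E).orthonormal.countable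
  have hi : Infinite (hsIndex E) := by
    rw [← not_finite_iff_infinite]
    intro h
    exact hE finiteDimensional_of_finite_hsIndex
  obtain ⟨e⟩ := nonempty_equiv_of_countable (α := ℕ) (β := hsIndex E)
  refine ⟨HilbertBasis.mk (v := hsBasis E ∘ e) ((hsBasis E).orthonormal.comp e e.injective) ?_⟩
  rw [e.surjective.range_comp, (hsBasis E).dense_span]

/-- Separable infinite-dimensional Hilbert spaces are isometric. -/
theorem nonempty_linearIsometryEquiv [TopologicalSpace.SeparableSpace E]
    [TopologicalSpace.SeparableSpace F] (hE : ¬ FiniteDimensional ℂ E)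
    (hF : ¬ FiniteDimensional ℂ F) : Nonempty (E ≃ₗᵢ[ℂ] F) := by
  obtain ⟨b⟩ := nonempty_hilbertBasis_nat hE
  obtain ⟨c⟩ := nonempty_hilbertBasis_nat hF
  exact ⟨b.repr.trans c.repr.symm⟩

/-- Isometries of the domain and of the codomain induce an isomorphism of the spaces of
Hilbert-Schmidt operators. -/
def HilbertSchmidt.congr {E' F' : Type*} [NormedAddCommGroup E'] [InnerProductSpace ℂ E']
    [CompleteSpace E'] [NormedAddCommGroup F'] [InnerProductSpace ℂ F'] [CompleteSpace F']
    (e : E ≃ₗᵢ[ℂ] E') (f : F ≃ₗᵢ[ℂ] F') : HilbertSchmidt E F ≃L[ℂ] HilbertSchmidt E' F' :=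
  ContinuousLinearEquiv.equivOfInverse
    (compRight.flip (e.symm : E' →L[ℂ] E) ∘L compLeft (f : F →L[ℂ] F'))
    (compRight.flip (e : E →L[ℂ] E') ∘L compLeft (f.symm : F' →L[ℂ] F))
    (fun T => toCLM_injective (by ext x; simp))
    (fun T => toCLM_injective (by ext x; simp))

end SeparableHilbert

/-! ### Projector description of the Grassmannian, model spaces, transitivity. -/

section Grassmannian

variable {H : Type*} [NormedAddCommGroup H] [InnerProductSpace ℂ H] [CompleteSpace H]

/-- The projector onto `U` is Hilbert-Schmidt, hence so is the one onto `V`; compressed to `V` it is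
the identity. -/
theorem finiteDimensional_of_isHilbertSchmidt_sub {U V : Submodule ℂ H} [CompleteSpace U]
    [CompleteSpace V] (h : IsHilbertSchmidt (U.starProjection - V.starProjection))
    [FiniteDimensional ℂ U] : FiniteDimensional ℂ V := by
  have hU : IsHilbertSchmidt U.starProjection :=
    (isHilbertSchmidt_of_finiteDimensional_codom U.orthogonalProjectionOnto).comp_left U.subtypeL
  have hV : IsHilbertSchmidt V.starProjection := by
    have := hU.sub h
    rwa [sub_sub_cancel] at this
  apply finiteDimensional_of_isHilbertSchmidt_id
  have := (hV.comp_left V.orthogonalProjectionOnto).comp_right V.subtypeL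
  convert this using 1
  ext x
  simp

/-- With `A = P₊|_W`, the point is to control the block `D = P_{W^⊥}|_{H₊}`, which the definition
does not mention. If `B` is a parametrix of `A`, then `D A B` equals minus the `W^⊥` component of
`P₋ B`, hence is Hilbert-Schmidt, and `A B - 1` has finite rank. Conversely, `P_W|_{H₊}` inverts `A`
modulo Hilbert-Schmidt operators. -/
theorem isRestricted_iff (Hp W : Submodule ℂ H) [CompleteSpace Hp] [CompleteSpace W] :
    IsRestricted Hp W ↔ IsHilbertSchmidt (W.starProjection - Hp.starProjection) := by
  constructor
  · rintro ⟨hA, hC⟩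
    obtain ⟨B, -, hB⟩ := hA.exists_isQuasiInverse
    have hB' : ((Hp.orthogonalProjectionOnto ∘L W.subtypeL) ∘L B
        - ContinuousLinearMap.id ℂ Hp).toLinearMap.HasFiniteRange :=
      LinearMap.FiniteRangeSetoid.equiv_iff_hasFiniteRange.1 hB
    have hfin := isHilbertSchmidt_of_hasFiniteRange hB'
    set D : Hp →L[ℂ] Wᗮ := Wᗮ.orthogonalProjectionOnto ∘L Hp.subtypeL with hD
    have hDHS : IsHilbertSchmidt D := by
      have h1 := ((hC.comp_left (Wᗮ.orthogonalProjectionOnto ∘L Hpᗮ.subtypeL)).comp_right B).neg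
      have h2 := h1.sub (hfin.comp_left D)
      convert h2 using 1
      ext x
      simp [hD]
    have h1 : IsHilbertSchmidt ((1 - Hp.starProjection) * W.starProjection) := by
      convert (hC.comp_left Hpᗮ.subtypeL).comp_right W.orthogonalProjectionOnto using 1
      ext x
      simp
    have h2 : IsHilbertSchmidt ((1 - W.starProjection) * Hp.starProjection) := by
      convert (hDHS.comp_left Wᗮ.subtypeL).comp_right Hp.orthogonalProjectionOnto using 1
      ext x
      simp [hD]
    have h3 : IsHilbertSchmidt (Hp.starProjection * (1 - W.starProjection)) := by
      have := h2.adjoint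
      rw [← ContinuousLinearMap.star_eq_adjoint] at this
      rwa [star_mul, star_sub, star_one, (isSelfAdjoint_starProjection Hp).star_eq,
        (isSelfAdjoint_starProjection W).star_eq] at this
    -- `P_W - P₊ = (1 - P₊) P_W - P₊ (1 - P_W)`.
    convert h1.sub h3 using 1
    noncomm_ring
  · intro h
    refine ⟨isFredholm_of_isHilbertSchmidt (B := W.orthogonalProjectionOnto ∘L Hp.subtypeL)
      ?_ ?_, ?_⟩
    · convert ((h.comp_left W.orthogonalProjectionOnto).comp_right W.subtypeL).neg using 1
      ext x
      simp
    · convert (h.comp_left Hp.orthogonalProjectionOnto).comp_right Hp.subtypeL using 1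
      ext x
      simp
    · convert (h.comp_left Hpᗮ.orthogonalProjectionOnto).comp_right W.subtypeL using 1
      ext x
      simp [Submodule.starProjection_eq_self_iff.2 (Hp.starProjection_apply_mem x)]

theorem mem_resGr_iff {Hp : Submodule ℂ H} [CompleteSpace Hp] {p : H →L[ℂ] H} :
    p ∈ ResGr Hp ↔ IsStarProjection p ∧ IsHilbertSchmidt (p - Hp.starProjection) := by
  constructor
  · rintro ⟨W, hW, hr, rfl⟩
    exact ⟨isStarProjection_starProjection, (isRestricted_iff Hp W).1 hr⟩
  · rintro ⟨hp, hs⟩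
    obtain ⟨W, hW, rfl⟩ := isStarProjection_iff_eq_starProjection.1 hp
    have : CompleteSpace W := by
      have hcl : IsClosed (W : Set H) := by
        rw [← W.orthogonal_orthogonal]
        exact Submodule.isClosed_orthogonal _
      exact hcl.completeSpace_coe
    exact ⟨W, this, (isRestricted_iff Hp W).2 hs, rfl⟩

variable {Hp : Submodule ℂ H} [CompleteSpace Hp]

namespace ResGr

theorem isStarProjection (p : ResGr Hp) : IsStarProjection (p : H →L[ℂ] H) :=
  (mem_resGr_iff.1 p.2).1

theorem space_eq (p : ResGr Hp) {W : Submodule ℂ H} [W.HasOrthogonalProjection]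
    (h : W.starProjection = p) : space p = W := by
  rw [space, ← h]
  exact W.range_starProjection

@[simp]
theorem starProjection_space (p : ResGr Hp) : (space p).starProjection = p := by
  obtain ⟨W, hW, -, h⟩ := p.2
  rw [← h]
  have := space_eq p h
  congr 1

theorem isHilbertSchmidt_sub_base (p : ResGr Hp) :
    IsHilbertSchmidt ((p : H →L[ℂ] H) - Hp.starProjection) :=
  (mem_resGr_iff.1 p.2).2

theorem isHilbertSchmidt_sub (p q : ResGr Hp) :
    IsHilbertSchmidt ((p : H →L[ℂ] H) - (q : H →L[ℂ] H)) := by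
  have := (ResGr.isHilbertSchmidt_sub_base p).sub (ResGr.isHilbertSchmidt_sub_base q)
  rwa [sub_sub_sub_cancel_right] at this

theorem space_injective : Function.Injective (space (Hp := Hp)) := by
  intro p q h
  apply Subtype.ext
  rw [← starProjection_space p, ← starProjection_space q]
  congr 1

theorem space_infinite (hp : ¬ FiniteDimensional ℂ Hp) (p : ResGr Hp) :
    ¬ FiniteDimensional ℂ (space p) := by
  intro h
  refine hp (finiteDimensional_of_isHilbertSchmidt_sub (U := space p) ?_)
  rw [starProjection_space]
  exact ResGr.isHilbertSchmidt_sub_base p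

theorem space_orthogonal_infinite (hm : ¬ FiniteDimensional ℂ Hpᗮ) (p : ResGr Hp) :
    ¬ FiniteDimensional ℂ (space p)ᗮ := by
  intro h
  refine hm (finiteDimensional_of_isHilbertSchmidt_sub (U := (space p)ᗮ) ?_)
  rw [Submodule.starProjection_orthogonal', Submodule.starProjection_orthogonal',
    sub_sub_sub_cancel_left, starProjection_space, ← neg_sub]
  exact (ResGr.isHilbertSchmidt_sub_base p).neg

theorem nonempty_model_equiv [TopologicalSpace.SeparableSpace H]
    (hp : ¬ FiniteDimensional ℂ Hp) (hm : ¬ FiniteDimensional ℂ Hpᗮ) (W : ResGr Hp) :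
    Nonempty (HilbertSchmidt (space W) (space W)ᗮ ≃L[ℂ] HilbertSchmidt Hp Hpᗮ) := by
  obtain ⟨e⟩ := nonempty_linearIsometryEquiv (ResGr.space_infinite hp W) hp
  obtain ⟨f⟩ := nonempty_linearIsometryEquiv (ResGr.space_orthogonal_infinite hm W) hm
  exact ⟨HilbertSchmidt.congr e f⟩

end ResGr

/-- An isometry between closed subspaces, extended by zero. -/
def extendIsometry {U V : Submodule ℂ H} [CompleteSpace U] (e : U ≃ₗᵢ[ℂ] V) : H →L[ℂ] H :=
  V.subtypeL ∘L (e : U →L[ℂ] V) ∘L U.orthogonalProjectionOnto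

theorem star_extendIsometry {U V : Submodule ℂ H} [CompleteSpace U] [CompleteSpace V]
    (e : U ≃ₗᵢ[ℂ] V) : star (extendIsometry e) = extendIsometry e.symm := by
  rw [ContinuousLinearMap.star_eq_adjoint, extendIsometry, extendIsometry,
    ContinuousLinearMap.adjoint_comp, ContinuousLinearMap.adjoint_comp,
    LinearIsometryEquiv.adjoint_eq_symm, Submodule.adjoint_subtypeL,
    Submodule.adjoint_orthogonalProjectionOnto, ContinuousLinearMap.comp_assoc]

theorem extendIsometry_mul_symm {U V : Submodule ℂ H} [CompleteSpace U] [CompleteSpace V]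
    (e : U ≃ₗᵢ[ℂ] V) : extendIsometry e * extendIsometry e.symm = V.starProjection := by
  ext x
  simp [extendIsometry]

theorem extendIsometry_symm_mul {U V : Submodule ℂ H} [CompleteSpace U] [CompleteSpace V]
    (e : U ≃ₗᵢ[ℂ] V) : extendIsometry e.symm * extendIsometry e = U.starProjection := by
  ext x
  simp [extendIsometry]

/-- Any two points are infinite-dimensional separable spaces, and an isometry between them extends
by zero to a partial isometry. -/
theorem URes.source_target_surjective [TopologicalSpace.SeparableSpace H]
    (hp : ¬ FiniteDimensional ℂ Hp) :
    Function.Surjective (fun u : URes Hp => (URes.source u, URes.target u)) := by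
  rintro ⟨p, q⟩
  obtain ⟨e⟩ := nonempty_linearIsometryEquiv (ResGr.space_infinite hp p) (ResGr.space_infinite hp q)
  have h1 : star (extendIsometry e) * extendIsometry e = p := by
    rw [star_extendIsometry, extendIsometry_symm_mul, ResGr.starProjection_space]
  have h2 : extendIsometry e * star (extendIsometry e) = q := by
    rw [star_extendIsometry, extendIsometry_mul_symm, ResGr.starProjection_space]
  refine ⟨⟨extendIsometry e, ?_, h1 ▸ p.2, h2 ▸ q.2⟩, Prod.ext (Subtype.ext h1) (Subtype.ext h2)⟩
  rw [IsPartialIsometry, h1]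
  exact ResGr.isStarProjection p

end Grassmannian

/-! ### A Hausdorff criterion for atlas topologies. -/

section Atlas

variable {M ι : Type*} {E : ι → Type*} [∀ i, NormedAddCommGroup (E i)] [∀ i, NormedSpace ℝ (E i)]

/-- The topology generated by an atlas is Hausdorff if there is an injective map to a Hausdorff
space that is continuous in the charts. -/
theorem t2Space_atlasTopology {src : ι → Set M} {φ : ∀ i, M → E i} {X : Type*}
    [TopologicalSpace X] [T2Space X] (hcover : ∀ x, ∃ i, x ∈ src i) {f : M → X}
    (hf : Function.Injective f)
    (h : ∀ i, IsOpen (φ i '' src i) ∧ ∃ g : E i → X, ContinuousOn g (φ i '' src i) ∧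
      ∀ x ∈ src i, g (φ i x) = f x) : @T2Space M (atlasTopology src φ) := by
  let _ := atlasTopology src φ
  refine T2Space.of_injective_continuous hf (continuous_def.2 fun O hO => ?_)
  choose hop g hg hgf using h
  -- Within each chart domain the preimage of `O` is the pullback of an open set of the model space,
  -- that is, a generator of the topology.
  have : f ⁻¹' O = ⋃ i, src i ∩ φ i ⁻¹' (φ i '' src i ∩ g i ⁻¹' O) := by
    ext x
    simp only [Set.mem_preimage, Set.mem_iUnion, Set.mem_inter_iff]
    constructor
    · intro hx
      obtain ⟨i, hi⟩ := hcover x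
      exact ⟨i, hi, ⟨x, hi, rfl⟩, by rwa [hgf i x hi]⟩
    · rintro ⟨i, hi, -, hx⟩
      rwa [hgf i x hi] at hx
  rw [this]
  refine isOpen_iUnion fun i => TopologicalSpace.GenerateOpen.basic _ ⟨i, _, ?_, rfl⟩
  exact (hg i).isOpen_inter_preimage (hop i) hO

end Atlas

/-! ### Projectors conjugated by units. -/

section StarRing

variable {R : Type*} [Ring R] [StarRing R]

/-- A conjugate of a projector is a projector under a commutation condition. -/
theorem IsStarProjection.conj_unit {p : R} (hp : IsStarProjection p) (u : Rˣ)
    (hc : p * (star (u : R) * u) = star (u : R) * u * p) :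
    IsStarProjection ((u : R) * p * ↑u⁻¹) := by
  refine ⟨?_, ?_⟩
  · have h := hp.isIdempotentElem.eq
    change (u : R) * p * ↑u⁻¹ * (u * p * ↑u⁻¹) = u * p * ↑u⁻¹
    calc (u : R) * p * ↑u⁻¹ * (u * p * ↑u⁻¹) = u * p * (↑u⁻¹ * u) * p * ↑u⁻¹ := by
          simp only [mul_assoc]
      _ = u * (p * p) * ↑u⁻¹ := by rw [Units.inv_mul, mul_one, mul_assoc (u : R) p p]
      _ = _ := by rw [h]
  · have h := hp.isSelfAdjoint.star_eq
    have hs : star (↑u⁻¹ : R) * star (u : R) = 1 := by rw [← star_mul, Units.mul_inv, star_one]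
    change star ((u : R) * p * ↑u⁻¹) = _
    rw [star_mul, star_mul, h]
    calc star (↑u⁻¹ : R) * (p * star (u : R))
        = star (↑u⁻¹ : R) * (p * (star (u : R) * u)) * ↑u⁻¹ := by
          simp only [mul_assoc, Units.mul_inv, mul_one]
      _ = star (↑u⁻¹ : R) * star (u : R) * u * p * ↑u⁻¹ := by rw [hc]; simp only [mul_assoc]
      _ = _ := by rw [hs, one_mul]

end StarRing

/-! ### Invertibility of `1 ± S` for skew-adjoint `S`. -/

section SkewAdjoint

variable {A : Type*} [CStarAlgebra A]

/-- `i S` is self-adjoint, so its spectrum is real and misses `i`; this makes `1 - S` a unit, and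
its adjoint is `1 + S`. -/
theorem isUnit_one_add_of_star_eq_neg {S : A} (hS : star S = -S) : IsUnit (1 + S) := by
  have hsa : IsSelfAdjoint (Complex.I • S) := by
    rw [IsSelfAdjoint, star_smul, hS]
    simp
  have hns : Complex.I ∉ spectrum ℂ (Complex.I • S) := by
    intro h
    have := hsa.im_eq_zero_of_mem_spectrum h
    simp at this
  rw [spectrum.notMem_iff] at hns
  have h2 : algebraMap ℂ A Complex.I - Complex.I • S = Complex.I • (1 - S) := by
    rw [Algebra.algebraMap_eq_smul_one, smul_sub]
  rw [h2] at hns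
  have h3 : IsUnit (1 - S) := by
    have := hns.smul (Units.mk0 (-Complex.I) (by simp))
    simpa [Units.smul_def, smul_smul] using this
  have := h3.star
  rwa [star_sub, star_one, hS, sub_neg_eq_add] at this

theorem isUnit_one_sub_of_star_eq_neg {S : A} (hS : star S = -S) : IsUnit (1 - S) := by
  rw [sub_eq_add_neg]
  exact isUnit_one_add_of_star_eq_neg (by rw [star_neg, hS])

end SkewAdjoint

/-! ### The orthogonal projector onto the graph of a Hilbert-Schmidt operator. -/

section Graph

variable {H : Type*} [NormedAddCommGroup H] [InnerProductSpace ℂ H] [CompleteSpace H]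

open HilbertSchmidt

section
variable (U : Submodule ℂ H) [CompleteSpace U]

/-- The parametrization `w ↦ w + T w` of the graph of `T : U → U^⊥`. -/
def graphMap (T : U →L[ℂ] Uᗮ) : U →L[ℂ] H := U.subtypeL + Uᗮ.subtypeL ∘L T

/-- A Hilbert-Schmidt operator `U → U^⊥`, extended by zero to the whole space. -/
def extendHS : HilbertSchmidt U Uᗮ →L[ℂ] HilbertSchmidt H H :=
  (compRight (E := H) (F := U) (G := H)).flip U.orthogonalProjectionOnto ∘L
    compLeft Uᗮ.subtypeL

/-- The skew-adjoint operator `T - T*`. -/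
def skewHS : HilbertSchmidt U Uᗮ →L[ℝ] HilbertSchmidt H H :=
  (extendHS U).restrictScalars ℝ - adjointL ∘L (extendHS U).restrictScalars ℝ

/-- The self-adjoint operator `T + T*`. -/
def symHS : HilbertSchmidt U Uᗮ →L[ℝ] HilbertSchmidt H H :=
  (extendHS U).restrictScalars ℝ + adjointL ∘L (extendHS U).restrictScalars ℝ

/-- The operator `1 + T - T*`, which maps `U` to the graph of `T`. -/
def graphShear (T : HilbertSchmidt U Uᗮ) : H →L[ℂ] H := 1 + toCLM H H (skewHS U T)

/-- The difference of the orthogonal projectors onto the graph of `T` and onto `U`. -/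
def graphDiff (T : HilbertSchmidt U Uᗮ) : HilbertSchmidt H H :=
  compRight (symHS U T) (Ring.inverse (graphShear U T))

/-- The orthogonal projector onto the graph of `T`. -/
def graphProj (T : HilbertSchmidt U Uᗮ) : H →L[ℂ] H :=
  U.starProjection + toCLM H H (graphDiff U T)

variable {U}
variable (T : HilbertSchmidt U Uᗮ)

theorem toCLM_skewHS : toCLM H H (skewHS U T) =
    toCLM H H (extendHS U T) - star (toCLM H H (extendHS U T)) := by
  simp [skewHS, ContinuousLinearMap.star_eq_adjoint]

theorem toCLM_symHS : toCLM H H (symHS U T) =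
    toCLM H H (extendHS U T) + star (toCLM H H (extendHS U T)) := by
  simp [symHS, ContinuousLinearMap.star_eq_adjoint]

theorem star_skewHS : star (toCLM H H (skewHS U T)) = - toCLM H H (skewHS U T) := by
  rw [toCLM_skewHS, star_sub, star_star, neg_sub]

theorem isUnit_graphShear : IsUnit (graphShear U T) :=
  isUnit_one_add_of_star_eq_neg (star_skewHS T)

theorem extendHS_mul_proj :
    toCLM H H (extendHS U T) * U.starProjection = toCLM H H (extendHS U T) := by
  ext x
  have h : U.orthogonalProjectionOnto (U.starProjection x) = U.orthogonalProjectionOnto x := by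
    rw [Submodule.starProjection_apply, Submodule.orthogonalProjectionOnto_mem_subspace_eq_self]
  simp [extendHS, h]

theorem proj_mul_extendHS : U.starProjection * toCLM H H (extendHS U T) = 0 := by
  ext x
  exact (Submodule.starProjection_apply_eq_zero_iff U).2 (Subtype.mem _)

theorem proj_mul_star_extendHS :
    U.starProjection * star (toCLM H H (extendHS U T)) = star (toCLM H H (extendHS U T)) := by
  have := congrArg star (extendHS_mul_proj T)
  rwa [star_mul, (isSelfAdjoint_starProjection U).star_eq] at this

theorem star_extendHS_mul_proj : star (toCLM H H (extendHS U T)) * U.starProjection = 0 := by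
  have := congrArg star (proj_mul_extendHS T)
  rwa [star_mul, (isSelfAdjoint_starProjection U).star_eq, star_zero] at this

theorem skewHS_mul_proj :
    toCLM H H (skewHS U T) * U.starProjection = toCLM H H (extendHS U T) := by
  rw [toCLM_skewHS, sub_mul, extendHS_mul_proj, star_extendHS_mul_proj, sub_zero]

theorem proj_mul_skewHS :
    U.starProjection * toCLM H H (skewHS U T) = -star (toCLM H H (extendHS U T)) := by
  rw [toCLM_skewHS, mul_sub, proj_mul_extendHS, proj_mul_star_extendHS, zero_sub]

theorem extendHS_mul_self : toCLM H H (extendHS U T) * toCLM H H (extendHS U T) = 0 := by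
  nth_rw 1 [← extendHS_mul_proj T]
  rw [mul_assoc, proj_mul_extendHS, mul_zero]

/-- `S = T - T*` exchanges `U` and `U^⊥`, so its square is block diagonal. -/
theorem proj_commute_skewHS_sq :
    U.starProjection * (toCLM H H (skewHS U T) * toCLM H H (skewHS U T)) =
      toCLM H H (skewHS U T) * toCLM H H (skewHS U T) * U.starProjection := by
  have h := congrArg star (extendHS_mul_self T)
  rw [star_mul, star_zero] at h
  rw [← mul_assoc, proj_mul_skewHS, mul_assoc _ _ U.starProjection, skewHS_mul_proj, toCLM_skewHS,
    mul_sub, sub_mul, extendHS_mul_self]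
  simp only [neg_mul, h]
  abel

theorem star_graphShear : star (graphShear U T) = 1 - toCLM H H (skewHS U T) := by
  rw [graphShear, star_add, star_one, star_skewHS, sub_eq_add_neg]

theorem star_graphShear_mul : star (graphShear U T) * graphShear U T =
    1 - toCLM H H (skewHS U T) * toCLM H H (skewHS U T) := by
  rw [star_graphShear, graphShear]
  noncomm_ring

theorem proj_commute_graphShear : U.starProjection * (star (graphShear U T) * graphShear U T) =
    star (graphShear U T) * graphShear U T * U.starProjection := by
  rw [star_graphShear_mul, mul_sub, sub_mul, proj_commute_skewHS_sq, mul_one, one_mul]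

/-- Since `S P - P S = T + T*`, one has `(1 + S) P = P (1 + S) + (T + T*)`. The definition displays
the Hilbert-Schmidt difference from `P`; this form displays a projector whose range is the image of
`U` under `1 + S`. -/
theorem graphProj_eq :
    graphProj U T = graphShear U T * U.starProjection * Ring.inverse (graphShear U T) := by
  have h : graphShear U T * U.starProjection =
      U.starProjection * graphShear U T + toCLM H H (symHS U T) := by
    rw [graphShear, add_mul, mul_add, skewHS_mul_proj, proj_mul_skewHS, toCLM_symHS]
    noncomm_ring
  rw [h, add_mul, mul_assoc, Ring.mul_inverse_cancel _ (isUnit_graphShear T), mul_one]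
  rfl

theorem isStarProjection_graphProj : IsStarProjection (graphProj U T) := by
  rw [graphProj_eq]
  obtain ⟨u, hu⟩ := isUnit_graphShear T
  have hc := proj_commute_graphShear T
  rw [← hu] at hc ⊢
  rw [Ring.inverse_unit]
  exact isStarProjection_starProjection.conj_unit u hc

theorem graphShear_apply (x : U) : graphShear U T x = graphMap U (toCLM U Uᗮ T) x := by
  have h : toCLM H H (skewHS U T) x = toCLM H H (extendHS U T) x := by
    rw [← skewHS_mul_proj]
    simp
  simp [graphShear, h, graphMap, extendHS]

theorem range_graphProj :
    (graphProj U T).range = (graphMap U (toCLM U Uᗮ T)).range := by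
  rw [graphProj_eq]
  ext y
  constructor
  · rintro ⟨x, rfl⟩
    exact ⟨U.orthogonalProjectionOnto (Ring.inverse (graphShear U T) x),
      (graphShear_apply T _).symm⟩
  · rintro ⟨x, rfl⟩
    refine ⟨graphShear U T x, ?_⟩
    have h : Ring.inverse (graphShear U T) (graphShear U T x) = x := by
      rw [← mul_apply_eq_comp, Ring.inverse_mul_cancel _ (isUnit_graphShear T)]
      rfl
    change graphShear U T (U.starProjection (Ring.inverse (graphShear U T) (graphShear U T x))) = _
    rw [h, Submodule.starProjection_mem_subspace_eq_self]
    exact graphShear_apply T x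

end

end Graph

/-! ### Charts of the Grassmannian and graphs as their inverses. -/

section GraphCharts

open HilbertSchmidt

variable {H : Type*} [NormedAddCommGroup H] [InnerProductSpace ℂ H] [CompleteSpace H]

section
variable {U : Submodule ℂ H} [CompleteSpace U]

theorem orthogonalProjectionOnto_comp_graphMap (T : U →L[ℂ] Uᗮ) :
    U.orthogonalProjectionOnto ∘L graphMap U T = ContinuousLinearMap.id ℂ U := by
  ext x
  have h : U.starProjection (T x : H) = 0 :=
    (Submodule.starProjection_apply_eq_zero_iff U).2 (T x).2
  simp [graphMap, h]

theorem orthogonalProjectionOnto_orthogonal_comp_graphMap (T : U →L[ℂ] Uᗮ) :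
    Uᗮ.orthogonalProjectionOnto ∘L graphMap U T = T := by
  ext x
  simp [graphMap]

end

variable {Hp : Submodule ℂ H} [CompleteSpace Hp]

namespace ResGr

/-- The projection `P_W|_V : V → W`. -/
def projOn (W V : ResGr Hp) : space V →L[ℂ] space W :=
  (space W).orthogonalProjectionOnto ∘L (space V).subtypeL

/-- The kernel of `P_W|_V` is `V ∩ W^⊥`, and it is onto exactly when `V + W^⊥` is everything; a
bounded bijection of Banach spaces has a bounded inverse. -/
theorem mem_chartDomain_iff (W V : ResGr Hp) :
    V ∈ chartDomain W ↔ (projOn W V).IsInvertible := by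
  have hker : ∀ x : space V, projOn W V x = 0 ↔ (x : H) ∈ (space W)ᗮ := by
    intro x
    rw [← Submodule.orthogonalProjectionOnto_eq_zero_iff]
    rfl
  constructor
  · intro (h : IsCompl (space V) (space W)ᗮ)
    have hinj : (projOn W V).ker = ⊥ := by
      rw [Submodule.eq_bot_iff]
      intro x hx
      have h0 : projOn W V x = 0 := hx
      have h1 : (x : H) = 0 := Submodule.disjoint_def.1 h.disjoint (x : H) x.2 ((hker x).1 h0)
      exact Subtype.ext h1
    have hsurj : (projOn W V).range = ⊤ := by
      rw [Submodule.eq_top_iff']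
      intro y
      have hy : (y : H) ∈ space V ⊔ (space W)ᗮ := by rw [h.sup_eq_top]; trivial
      obtain ⟨v, hv, z, hz, hvz⟩ := Submodule.mem_sup.1 hy
      refine ⟨⟨v, hv⟩, ?_⟩
      change (space W).orthogonalProjectionOnto v = y
      have : v = y - z := by rw [← hvz]; abel
      rw [this, map_sub, Submodule.orthogonalProjectionOnto_eq_zero_iff.2 hz, sub_zero,
        Submodule.orthogonalProjectionOnto_mem_subspace_eq_self]
    exact ⟨ContinuousLinearEquiv.ofBijective _ hinj hsurj, rfl⟩
  · intro h
    refine IsCompl.of_eq ?_ ?_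
    · rw [Submodule.eq_bot_iff]
      rintro x ⟨hx, hx'⟩
      have h0 : (⟨x, hx⟩ : space V) = 0 := by
        apply h.injective
        rw [map_zero]
        exact (hker ⟨x, hx⟩).2 hx'
      exact congrArg Subtype.val h0
    · rw [Submodule.eq_top_iff']
      intro x
      obtain ⟨v, hv⟩ := h.surjective ((space W).orthogonalProjectionOnto x)
      refine Submodule.mem_sup.2 ⟨v, v.2, x - v, ?_, by abel⟩
      rw [← Submodule.orthogonalProjectionOnto_eq_zero_iff, map_sub, ← hv]
      exact sub_self _

/-- On `V` this operator is `P_{W^⊥} (P_V - P_W)`. -/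
theorem isHilbertSchmidt_orthogonal_proj (W V : ResGr Hp) :
    IsHilbertSchmidt ((space W)ᗮ.orthogonalProjectionOnto ∘L (space V).subtypeL) := by
  have h := ((isHilbertSchmidt_sub V W).comp_left
    (space W)ᗮ.orthogonalProjectionOnto).comp_right (space V).subtypeL
  convert h using 1
  have h1 : ∀ x : H, (space W)ᗮ.orthogonalProjectionOnto ((W : H →L[ℂ] H) x) = 0 := by
    intro x
    rw [← starProjection_space W, Submodule.orthogonalProjectionOnto_eq_zero_iff,
      Submodule.orthogonal_orthogonal]
    exact Submodule.starProjection_apply_mem _ _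
  have h2 : ∀ x : space V, (V : H →L[ℂ] H) x = x := by
    intro x
    conv_lhs => rw [← starProjection_space V]
    exact Submodule.starProjection_mem_subspace_eq_self x
  ext x
  simp [h1, h2]

theorem isHilbertSchmidt_chartOp (W V : ResGr Hp) : IsHilbertSchmidt (chartOp W V) :=
  (isHilbertSchmidt_orthogonal_proj W V).comp_right _

@[simp]
theorem toCLM_chart (W V : ResGr Hp) : toCLM _ _ (chart W V) = chartOp W V :=
  toCLM_ofCLM (isHilbertSchmidt_chartOp W V)

section Parametrized

variable {E : Type*} [NormedAddCommGroup E] [InnerProductSpace ℂ E]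
  {V : ResGr Hp} (L : E →L[ℂ] H) (R : H →L[ℂ] E)

/-- A parametrization of a point of the Grassmannian, as an isomorphism. -/
def paramEquiv (hL : L.range = space V) (hR : R ∘L L = ContinuousLinearMap.id ℂ E) :
    E ≃L[ℂ] space V :=
  ContinuousLinearEquiv.equivOfInverse
    (L.codRestrict (space V) fun x => hL ▸ ⟨x, rfl⟩) (R ∘L (space V).subtypeL)
    (fun x => congrArg (fun A : E →L[ℂ] E => A x) hR)
    (fun y => by
      apply Subtype.ext
      obtain ⟨y, hy⟩ := y
      rw [← hL] at hy
      obtain ⟨x, rfl⟩ := hy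
      exact congrArg L (congrArg (fun A : E →L[ℂ] E => A x) hR))

variable {L R}

theorem subtypeL_comp_paramEquiv (hL : L.range = space V)
    (hR : R ∘L L = ContinuousLinearMap.id ℂ E) :
    (space V).subtypeL ∘L (paramEquiv L R hL hR : E →L[ℂ] space V) = L := rfl

/-- A parametrization by a fixed space `E` replaces the varying domain `V`, so that invertibility
becomes a condition in a single operator space. -/
theorem mem_chartDomain_iff_of_range (W : ResGr Hp) (hL : L.range = space V)
    (hR : R ∘L L = ContinuousLinearMap.id ℂ E) :
    V ∈ chartDomain W ↔ ((space W).orthogonalProjectionOnto ∘L L).IsInvertible := by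
  rw [mem_chartDomain_iff]
  conv_rhs => rw [← subtypeL_comp_paramEquiv hL hR, ← ContinuousLinearMap.comp_assoc,
    ContinuousLinearMap.isInvertible_comp_equiv]
  rfl

theorem chartOp_of_range (W : ResGr Hp) (hL : L.range = space V)
    (hR : R ∘L L = ContinuousLinearMap.id ℂ E) :
    chartOp W V = ((space W)ᗮ.orthogonalProjectionOnto ∘L L) ∘L
      ContinuousLinearMap.inverse ((space W).orthogonalProjectionOnto ∘L L) := by
  have h1 : (space W).orthogonalProjectionOnto ∘L L =
      ((space W).orthogonalProjectionOnto ∘L (space V).subtypeL) ∘L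
        (paramEquiv L R hL hR : E →L[ℂ] space V) := rfl
  rw [h1, ContinuousLinearMap.inverse_comp_equiv, chartOp]
  have h2 : (space W)ᗮ.orthogonalProjectionOnto ∘L L =
      ((space W)ᗮ.orthogonalProjectionOnto ∘L (space V).subtypeL) ∘L
        (paramEquiv L R hL hR : E →L[ℂ] space V) := rfl
  rw [h2]
  ext x
  simp

end Parametrized

/-- The graph of a Hilbert-Schmidt operator `W → W^⊥`, as a point of the Grassmannian. -/
def ofGraph (W : ResGr Hp) (T : HilbertSchmidt (space W) (space W)ᗮ) : ResGr Hp :=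
  ⟨graphProj (space W) T, mem_resGr_iff.2 ⟨isStarProjection_graphProj T, by
    rw [graphProj, starProjection_space, add_sub_right_comm]
    exact (isHilbertSchmidt_sub_base W).add (graphDiff (space W) T).isHilbertSchmidt⟩⟩

theorem coe_ofGraph (W : ResGr Hp) (T : HilbertSchmidt (space W) (space W)ᗮ) :
    (ofGraph W T : H →L[ℂ] H) = graphProj (space W) T := rfl

variable (W : ResGr Hp) (T : HilbertSchmidt (space W) (space W)ᗮ)

theorem range_graphMap : (graphMap (space W) (toCLM _ _ T)).range = space (ofGraph W T) :=
  (range_graphProj T).symm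

theorem ofGraph_mem_chartDomain_iff (W' : ResGr Hp) : ofGraph W T ∈ chartDomain W' ↔
    ((space W').orthogonalProjectionOnto ∘L graphMap (space W) (toCLM _ _ T)).IsInvertible :=
  mem_chartDomain_iff_of_range W' (range_graphMap W T) (orthogonalProjectionOnto_comp_graphMap _)

theorem chartOp_ofGraph (W' : ResGr Hp) : chartOp W' (ofGraph W T) =
    ((space W')ᗮ.orthogonalProjectionOnto ∘L graphMap (space W) (toCLM _ _ T)) ∘L
      ContinuousLinearMap.inverse
        ((space W').orthogonalProjectionOnto ∘L graphMap (space W) (toCLM _ _ T)) :=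
  chartOp_of_range W' (range_graphMap W T) (orthogonalProjectionOnto_comp_graphMap _)

theorem ofGraph_mem_chartDomain : ofGraph W T ∈ chartDomain W := by
  rw [ofGraph_mem_chartDomain_iff, orthogonalProjectionOnto_comp_graphMap]
  exact ⟨ContinuousLinearEquiv.refl ℂ _, rfl⟩

@[simp]
theorem chart_ofGraph : chart W (ofGraph W T) = T := by
  apply toCLM_injective
  rw [toCLM_chart, chartOp_ofGraph, orthogonalProjectionOnto_comp_graphMap,
    orthogonalProjectionOnto_orthogonal_comp_graphMap, ContinuousLinearMap.inverse_id,
    ContinuousLinearMap.comp_id]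

variable {W}

/-- Each `v ∈ V` is the sum of its components in `W` and `W^⊥`, and the chart operator sends the
first to the second; thus `V` is its graph. -/
theorem ofGraph_chart {V : ResGr Hp} (hV : V ∈ chartDomain W) : ofGraph W (chart W V) = V := by
  apply space_injective
  rw [← range_graphMap, toCLM_chart]
  have hinv := (mem_chartDomain_iff W V).1 hV
  have key : ∀ v : space V,
      graphMap (space W) (chartOp W V) (projOn W V v) = v := by
    intro v
    have h1 : chartOp W V (projOn W V v) = (space W)ᗮ.orthogonalProjectionOnto v :=
      congrArg (fun z : space V => (space W)ᗮ.orthogonalProjectionOnto (z : H))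
        (hinv.inverse_apply_self v)
    have h2 : graphMap (space W) (chartOp W V) (projOn W V v) =
        (projOn W V v : H) + (chartOp W V (projOn W V v) : H) := rfl
    rw [h2, h1]
    exact (space W).starProjection_add_starProjection_orthogonal (v : H)
  ext x
  constructor
  · rintro ⟨w, rfl⟩
    obtain ⟨v, rfl⟩ := hinv.surjective w
    change graphMap (space W) (chartOp W V) (projOn W V v) ∈ _
    rw [key]
    exact v.2
  · intro hx
    exact ⟨projOn W V ⟨x, hx⟩, key ⟨x, hx⟩⟩

theorem chart_image (S : Set (ResGr Hp)) :
    chart W '' (chartDomain W ∩ S) = {T | ofGraph W T ∈ S} := by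
  ext T
  constructor
  · rintro ⟨V, ⟨hV, hS⟩, rfl⟩
    change ofGraph W (chart W V) ∈ S
    rwa [ofGraph_chart hV]
  · intro hT
    exact ⟨ofGraph W T, ⟨ofGraph_mem_chartDomain W T, hT⟩, chart_ofGraph W T⟩

theorem chart_image_chartDomain : chart W '' chartDomain W = Set.univ := by
  have := chart_image (W := W) Set.univ
  rwa [Set.inter_univ] at this

theorem chart_image_of_subset {S : Set (ResGr Hp)} (hS : S ⊆ chartDomain W) :
    chart W '' S = {T | ofGraph W T ∈ S} := by
  rw [← chart_image, Set.inter_eq_right.2 hS]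

variable (W)

theorem base_mem_chartDomain : W ∈ chartDomain W :=
  Submodule.isCompl_orthogonal (space W)

/-- The block `W → W'^⊥` of the parametrization of the graph of `T`. -/
def offBlock (W W' : ResGr Hp) (T : HilbertSchmidt (space W) (space W)ᗮ) :
    HilbertSchmidt (space W) (space W')ᗮ :=
  mk _ (isHilbertSchmidt_orthogonal_proj W' W) +
    compLeft ((space W')ᗮ.orthogonalProjectionOnto ∘L (space W)ᗮ.subtypeL) T

theorem toCLM_offBlock (W W' : ResGr Hp) (T : HilbertSchmidt (space W) (space W)ᗮ) :
    toCLM _ _ (offBlock W W' T) =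
      (space W')ᗮ.orthogonalProjectionOnto ∘L graphMap (space W) (toCLM _ _ T) := by
  rw [offBlock, map_add, toCLM_mk, toCLM_compLeft, graphMap, ContinuousLinearMap.comp_add,
    ContinuousLinearMap.comp_assoc]

/-- The change of charts. -/
def transition (W W' : ResGr Hp) (T : HilbertSchmidt (space W) (space W)ᗮ) :
    HilbertSchmidt (space W') (space W')ᗮ :=
  compRight (offBlock W W' T) (ContinuousLinearMap.inverse
    ((space W').orthogonalProjectionOnto ∘L graphMap (space W) (toCLM _ _ T)))

/-- `transition` only involves operators on the fixed space `W`, with the off-diagonal block already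
taken in `L²`; this is the form in which smoothness can be read off. -/
theorem transition_eq (W W' : ResGr Hp) (T : HilbertSchmidt (space W) (space W)ᗮ) :
    transition W W' T = chart W' (ofGraph W T) := by
  apply toCLM_injective
  rw [toCLM_chart, chartOp_ofGraph, transition, toCLM_compRight, toCLM_offBlock]

end ResGr

end GraphCharts

/-! ### Real smoothness of compositions, products and inverses over `ℂ`. -/

section RealSmooth

variable {X Y Z V : Type*} [NormedAddCommGroup X] [NormedSpace ℂ X] [NormedSpace ℝ X]
  [IsScalarTower ℝ ℂ X] [NormedAddCommGroup Y] [NormedSpace ℂ Y] [NormedSpace ℝ Y]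
  [IsScalarTower ℝ ℂ Y] [NormedAddCommGroup Z] [NormedSpace ℂ Z] [NormedSpace ℝ Z]
  [IsScalarTower ℝ ℂ Z] [NormedAddCommGroup V] [NormedSpace ℝ V] {n : WithTop ℕ∞} {s : Set V}

theorem ContDiffOn.clm_apply₂ (B : X →L[ℂ] Y →L[ℂ] Z) {f : V → X} {g : V → Y}
    (hf : ContDiffOn ℝ n f s) (hg : ContDiffOn ℝ n g s) :
    ContDiffOn ℝ n (fun v => B (f v) (g v)) s :=
  (B.isBoundedBilinearMap.contDiff.restrict_scalars ℝ).comp_contDiffOn (hf.prodMk hg)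

theorem ContDiffOn.complex_clm (B : X →L[ℂ] Y) {f : V → X} (hf : ContDiffOn ℝ n f s) :
    ContDiffOn ℝ n (fun v => B (f v)) s :=
  (B.contDiff.restrict_scalars ℝ).comp_contDiffOn hf

theorem ContDiffOn.ringInverse {R : Type*} [NormedRing R] [NormedAlgebra ℂ R] [CompleteSpace R]
    [NormedSpace ℝ R] [IsScalarTower ℝ ℂ R] {f : V → R} (hf : ContDiffOn ℝ n f s)
    (hu : ∀ v ∈ s, IsUnit (f v)) : ContDiffOn ℝ n (fun v => Ring.inverse (f v)) s := by
  intro v hv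
  obtain ⟨u, hu⟩ := hu v hv
  have h := (contDiffAt_ringInverse ℂ (n := n) u).restrict_scalars ℝ
  rw [hu] at h
  exact h.comp_contDiffWithinAt v (hf v hv)

theorem ContDiffOn.ring_mul {R : Type*} [NormedRing R] [NormedAlgebra ℂ R]
    [NormedSpace ℝ R] [IsScalarTower ℝ ℂ R] {f g : V → R} (hf : ContDiffOn ℝ n f s)
    (hg : ContDiffOn ℝ n g s) : ContDiffOn ℝ n (fun v => f v * g v) s :=
  ContDiffOn.clm_apply₂ (ContinuousLinearMap.mul ℂ R) hf hg

theorem ContDiffOn.clm_inverse {X Y : Type*} [NormedAddCommGroup X] [NormedSpace ℂ X]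
    [CompleteSpace X] [NormedAddCommGroup Y] [NormedSpace ℂ Y] {f : V → X →L[ℂ] Y}
    (hf : ContDiffOn ℝ n f s) (hu : ∀ v ∈ s, (f v).IsInvertible) :
    ContDiffOn ℝ n (fun v => (f v).inverse) s := by
  intro v hv
  obtain ⟨e, he⟩ := hu v hv
  have h := (contDiffAt_map_inverse (n := n) e).restrict_scalars ℝ
  rw [he] at h
  exact h.comp_contDiffWithinAt v (hf v hv)

end RealSmooth

/-! ### Smoothness of graph projectors and of the changes of charts. -/

section GraphSmooth

open HilbertSchmidt

variable {H : Type*} [NormedAddCommGroup H] [InnerProductSpace ℂ H] [CompleteSpace H]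

section
variable (U : Submodule ℂ H) [CompleteSpace U]

theorem contDiff_graphShear : ContDiff ℝ ∞ (graphShear U) := by
  rw [← contDiffOn_univ]
  exact contDiffOn_const.add
    ((skewHS U).contDiff.contDiffOn.complex_clm (toCLML H H))

theorem contDiff_graphDiff : ContDiff ℝ ∞ (graphDiff U) := by
  rw [← contDiffOn_univ]
  exact ContDiffOn.clm_apply₂ compRight (symHS U).contDiff.contDiffOn
    ((contDiff_graphShear U).contDiffOn.ringInverse fun T _ => isUnit_graphShear T)

theorem contDiff_graphProj : ContDiff ℝ ∞ (graphProj U) := by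
  rw [← contDiffOn_univ]
  exact contDiffOn_const.add ((contDiff_graphDiff U).contDiffOn.complex_clm (toCLML H H))

end

variable {Hp : Submodule ℂ H} [CompleteSpace Hp]

namespace ResGr

theorem contDiff_compressed_graphMap (W W' : ResGr Hp) :
    ContDiff ℝ ∞ fun T : HilbertSchmidt (space W) (space W)ᗮ =>
      (space W').orthogonalProjectionOnto ∘L graphMap (space W) (toCLM _ _ T) := by
  rw [← contDiffOn_univ]
  have h1 : ContDiffOn ℝ ∞ (fun T : HilbertSchmidt (space W) (space W)ᗮ =>
      graphMap (space W) (toCLM _ _ T)) Set.univ :=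
    contDiffOn_const.add (contDiffOn_id.complex_clm
      (ContinuousLinearMap.compL ℂ (space W) (space W)ᗮ H (space W)ᗮ.subtypeL ∘L toCLML _ _))
  exact h1.complex_clm
    (ContinuousLinearMap.compL ℂ (space W) H (space W') (space W').orthogonalProjectionOnto)

/-- The domain of the change of charts. -/
def overlap (W W' : ResGr Hp) : Set (HilbertSchmidt (space W) (space W)ᗮ) :=
  {T | ofGraph W T ∈ chartDomain W'}

/-- The condition is invertibility of an operator depending continuously on `T`, and invertible
operators form an open set. -/
theorem isOpen_overlap (W W' : ResGr Hp) : IsOpen (overlap W W') := by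
  have h : overlap W W' = (fun T : HilbertSchmidt (space W) (space W)ᗮ =>
      (space W').orthogonalProjectionOnto ∘L graphMap (space W) (toCLM _ _ T)) ⁻¹'
      Set.range ((↑) : (space W ≃L[ℂ] space W') → space W →L[ℂ] space W') := by
    ext T
    exact ofGraph_mem_chartDomain_iff W T W'
  rw [h]
  exact (ContinuousLinearEquiv.isOpen).preimage (contDiff_compressed_graphMap W W').continuous

theorem contDiffOn_transition (W W' : ResGr Hp) :
    ContDiffOn ℝ ∞ (transition W W') (overlap W W') := by
  have h1 : ContDiffOn ℝ ∞ (offBlock W W') (overlap W W') :=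
    contDiffOn_const.add (contDiffOn_id.complex_clm _)
  exact ContDiffOn.clm_apply₂ compRight h1
    ((contDiff_compressed_graphMap W W').contDiffOn.clm_inverse fun T hT =>
      (ofGraph_mem_chartDomain_iff W T W').1 hT)

theorem chart_injOn (W : ResGr Hp) : Set.InjOn (chart W) (chartDomain W) := by
  intro V hV V' hV' h
  rw [← ofGraph_chart hV, h, ofGraph_chart hV']

/-- The restricted Grassmannian is a smooth Hausdorff Banach manifold. -/
theorem isBanachManifoldAtlas :
    IsBanachManifoldAtlas (chartDomain (Hp := Hp)) chart where
  complete _ := inferInstance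
  cover W := ⟨W, base_mem_chartDomain W⟩
  injOn := chart_injOn
  isOpen_image W W' := by
    rw [chart_image]
    exact isOpen_overlap W W'
  smooth_transition W W' := by
    refine ⟨transition W W', ?_, ?_⟩
    · rw [chart_image]
      exact contDiffOn_transition W W'
    · rintro V ⟨hV, -⟩
      rw [transition_eq, ofGraph_chart hV]
  hausdorff := by
    -- Points are separated by their projectors, which in the chart at `W` are the graph projectors.
    refine t2Space_atlasTopology (fun W => ⟨W, base_mem_chartDomain W⟩)
      (f := fun V : ResGr Hp => (V : H →L[ℂ] H)) Subtype.val_injective fun W => ?_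
    rw [chart_image_chartDomain]
    refine ⟨isOpen_univ, graphProj (space W), (contDiff_graphProj _).continuous.continuousOn, ?_⟩
    intro V hV
    rw [← coe_ofGraph, ofGraph_chart hV]

end ResGr

end GraphSmooth

/-! ### A smooth square root near the identity. -/

section SquareRoot

variable {A : Type*} [CStarAlgebra A]

/-- A holomorphic square root near the unit of a `C*`-algebra, compatible with the involution and
with commutation with projectors. -/
theorem exists_local_sqrt : ∃ (r : A → A) (δ : ℝ), 0 < δ ∧
    ContDiffOn ℂ ω r (Metric.ball 1 δ) ∧ ∀ a ∈ Metric.ball (1 : A) δ,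
      r a * r a = a ∧ IsUnit (r a) ∧ (IsSelfAdjoint a → IsSelfAdjoint (r a)) ∧
      ∀ p : A, IsStarProjection p → p * a = a * p → p * r a = r a * p := by
  let f : A → A := fun y => y * y
  have hf : ContDiff ℂ ω f := contDiff_id.mul contDiff_id
  -- The derivative of `y ↦ y²` at `1` is multiplication by `2`, so the inverse function theorem
  -- applies.
  let L : A ≃L[ℂ] A := ContinuousLinearEquiv.smulLeft (Units.mk0 (2 : ℂ) two_ne_zero)
  have hL : HasFDerivAt f (L : A →L[ℂ] A) 1 := by
    have h := (hasFDerivAt_id (𝕜 := ℂ) (1 : A)).mul' (hasFDerivAt_id (𝕜 := ℂ) (1 : A))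
    refine h.congr_fderiv ?_
    ext x
    simp [L, Units.smul_def, two_smul]
  let e := hf.contDiffAt.toOpenPartialHomeomorph f hL (by simp)
  have he : ∀ y, e y = y * y := fun y => rfl
  have h1s : (1 : A) ∈ e.source := hf.contDiffAt.mem_toOpenPartialHomeomorph_source hL (by simp)
  have h11 : e 1 = 1 := by rw [he, one_mul]
  have h1t : (1 : A) ∈ e.target := h11 ▸ e.map_source h1s
  have hr1 : e.symm 1 = 1 := by
    conv_lhs => rw [← h11]
    exact e.left_inv h1s
  have hsm : ContDiffAt ℂ ω e.symm 1 := by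
    have := hf.contDiffAt.to_localInverse (a := (1 : A)) hL (by simp)
    have h11' : f 1 = 1 := one_mul 1
    rw [h11'] at this
    exact this
  obtain ⟨t, ht, hct⟩ := hsm.contDiffOn (m := ω) le_rfl (by simp)
  obtain ⟨ε, hε, hεs⟩ := Metric.isOpen_iff.1 e.open_source 1 h1s
  -- Radius `ε` gives uniqueness of the root; radius `1` makes the root invertible.
  have hball : Metric.ball (1 : A) (min ε 1) ∈ nhds (e.symm 1) := by
    rw [hr1]; exact Metric.ball_mem_nhds _ (lt_min hε one_pos)
  have hev := (hsm.continuousAt.eventually hball)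
  have htar := e.open_target.mem_nhds h1t
  have ht' : t ∈ nhds (1 : A) := by simpa using ht
  obtain ⟨δ, hδ, hsub⟩ := Metric.mem_nhds_iff.1 (Filter.inter_mem (Filter.inter_mem hev htar) ht')
  refine ⟨e.symm, δ, hδ, hct.mono fun a ha => (hsub ha).2, fun a ha => ?_⟩
  obtain ⟨⟨hrb, hat⟩, -⟩ := hsub ha
  have hrb : ‖e.symm a - 1‖ < min ε 1 := mem_ball_iff_norm.1 hrb
  have hsq : e.symm a * e.symm a = a := e.right_inv hat
  -- Uniqueness of roots near `1` carries the symmetries: the adjoint of the root, or its conjugate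
  -- by a unitary commuting with `a`, is again a root of `a` (for the adjoint, when `a` is
  -- self-adjoint) at the same distance from `1`.
  have huniq : ∀ y : A, ‖y - 1‖ < min ε 1 → y * y = a → y = e.symm a := by
    intro y hy hya
    refine e.injOn (hεs (mem_ball_iff_norm.2 (hy.trans_le (min_le_left _ _))))
      (hεs (mem_ball_iff_norm.2 (hrb.trans_le (min_le_left _ _)))) ?_
    rw [he, he, hya, hsq]
  refine ⟨hsq, ?_, ?_, ?_⟩
  · have := isUnit_one_sub_of_norm_lt_one (x := 1 - e.symm a)
      (by rw [norm_sub_rev]; exact hrb.trans_le (min_le_right _ _))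
    simpa using this
  · intro hsa
    refine huniq _ ?_ ?_
    · rwa [← star_one, ← star_sub, norm_star]
    · rw [← star_mul, hsq, hsa.star_eq]
  · intro p hp hpa
    have hpp : p * p = p := hp.isIdempotentElem.eq
    -- The reflection `2p - 1` is unitary, and commuting with it is the same as commuting with `p`.
    obtain ⟨s, hs⟩ : ∃ s : A, s = 2 * p - 1 := ⟨_, rfl⟩
    have hss : s * s = 1 := by
      have : s * s = 4 * (p * p) - 4 * p + 1 := by rw [hs]; noncomm_ring
      rw [this, hpp]; noncomm_ring
    have hst : star s = s := by
      rw [hs, star_sub, star_mul, star_one, hp.isSelfAdjoint.star_eq, star_ofNat]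
      noncomm_ring
    have hsu : s ∈ unitary A := by
      rw [Unitary.mem_iff, hst]; exact ⟨hss, hss⟩
    have hsa : s * a = a * s := by
      have h1 : s * a = 2 * (p * a) - a := by rw [hs]; noncomm_ring
      have h2 : a * s = 2 * (a * p) - a := by rw [hs]; noncomm_ring
      rw [h1, h2, hpa]
    have hconj : s * e.symm a * s = e.symm a := by
      refine huniq _ ?_ ?_
      · have : s * e.symm a * s - 1 = s * (e.symm a - 1) * s := by
          rw [mul_sub, sub_mul, mul_one, hss]
        rw [this, CStarRing.norm_mul_mem_unitary _ hsu, CStarRing.norm_mem_unitary_mul _ hsu]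
        exact hrb
      · calc s * e.symm a * s * (s * e.symm a * s)
            = s * e.symm a * (s * s) * e.symm a * s := by simp only [mul_assoc]
          _ = s * (e.symm a * e.symm a) * s := by rw [hss, mul_one]; simp only [mul_assoc]
          _ = a := by rw [hsq, hsa, mul_assoc, hss, mul_one]
    have hcomm : s * e.symm a = e.symm a * s := by
      calc s * e.symm a = s * e.symm a * (s * s) := by rw [hss, mul_one]
        _ = s * e.symm a * s * s := by simp only [mul_assoc]
        _ = _ := by rw [hconj]
    have h1 : s * e.symm a = 2 * (p * e.symm a) - e.symm a := by rw [hs]; noncomm_ring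
    have h2 : e.symm a * s = 2 * (e.symm a * p) - e.symm a := by rw [hs]; noncomm_ring
    rw [h1, h2, sub_left_inj] at hcomm
    have h2u : IsUnit (2 : A) := by
      have := (IsUnit.mk0 (2 : ℂ) two_ne_zero).map (algebraMap ℂ A)
      rwa [map_ofNat] at this
    exact h2u.mul_left_cancel hcomm

end SquareRoot

/-! ### Smooth maps into the algebra of restricted operators. -/

section ResOp

open HilbertSchmidt

variable {H : Type*} [NormedAddCommGroup H] [InnerProductSpace ℂ H] [CompleteSpace H]
variable (Hp : Submodule ℂ H) [CompleteSpace Hp]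

theorem commProj_apply (X : H →L[ℂ] H) :
    commProj Hp X = X * Hp.starProjection - Hp.starProjection * X := rfl

namespace ResOp

/-- The diagonal part of the first component plus the off-diagonal part whose commutator with the
projector is the off-diagonal part of the second component. -/
def reconstruct : (H →L[ℂ] H) × HilbertSchmidt H H →L[ℂ] (H →L[ℂ] H) :=
  (ContinuousLinearMap.mulLeftRight ℂ _ Hp.starProjection Hp.starProjection +
    ContinuousLinearMap.mulLeftRight ℂ _ (1 - Hp.starProjection) (1 - Hp.starProjection)) ∘L
      ContinuousLinearMap.fst ℂ _ _ +
  (ContinuousLinearMap.mulLeftRight ℂ _ (1 - Hp.starProjection) Hp.starProjection -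
    ContinuousLinearMap.mulLeftRight ℂ _ Hp.starProjection (1 - Hp.starProjection)) ∘L
      HilbertSchmidt.toCLML H H ∘L ContinuousLinearMap.snd ℂ _ _

/-- The off-diagonal part of a Hilbert-Schmidt operator. -/
def offDiagonal : HilbertSchmidt H H →L[ℂ] HilbertSchmidt H H :=
  (compRight (E := H) (F := H) (G := H)).flip Hp.starProjection ∘L
      compLeft (1 - Hp.starProjection) +
    (compRight (E := H) (F := H) (G := H)).flip (1 - Hp.starProjection) ∘L
      compLeft Hp.starProjection

theorem proj_mul_proj : Hp.starProjection * Hp.starProjection = Hp.starProjection :=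
  Hp.isIdempotentElem_starProjection.eq

theorem reconstruct_apply (X : H →L[ℂ] H) (K : HilbertSchmidt H H) :
    reconstruct Hp (X, K) = Hp.starProjection * X * Hp.starProjection +
      (1 - Hp.starProjection) * X * (1 - Hp.starProjection) +
      ((1 - Hp.starProjection) * HilbertSchmidt.toCLM H H K * Hp.starProjection -
        Hp.starProjection * HilbertSchmidt.toCLM H H K * (1 - Hp.starProjection)) := by
  simp only [reconstruct, add_apply, sub_apply, ContinuousLinearMap.comp_apply,
    ContinuousLinearMap.coe_fst', ContinuousLinearMap.coe_snd',
    ContinuousLinearMap.mulLeftRight_apply, HilbertSchmidt.toCLML_apply]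

theorem toCLM_offDiagonal (K : HilbertSchmidt H H) :
    HilbertSchmidt.toCLM H H (offDiagonal Hp K) = (1 - Hp.starProjection) * HilbertSchmidt.toCLM H H K * Hp.starProjection +
        Hp.starProjection * HilbertSchmidt.toCLM H H K * (1 - Hp.starProjection) := rfl

/-- The diagonal blocks commute with `P₊`, and the commutator multiplies the two off-diagonal blocks
by `1` and `-1`, cancelling the signs in `reconstruct`. For every pair the commutator is therefore
Hilbert-Schmidt, with a bound linear in the pair. -/
theorem commProj_reconstruct (x : (H →L[ℂ] H) × HilbertSchmidt H H) :
    commProj Hp (reconstruct Hp x) = HilbertSchmidt.toCLM H H (offDiagonal Hp x.2) := by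
  obtain ⟨X, K⟩ := x
  have hP := proj_mul_proj Hp
  rw [toCLM_offDiagonal, commProj_apply, reconstruct_apply]
  set P := Hp.starProjection
  have h1 : (1 - P) * P = 0 := by rw [sub_mul, hP, one_mul, sub_self]
  have h2 : P * (1 - P) = 0 := by rw [mul_sub, hP, mul_one, sub_self]
  simp only [add_mul, sub_mul (_ * _ * _), mul_add, mul_sub P (_ * _ * _), mul_assoc _ P P,
    mul_assoc _ (1 - P) P, h1, hP, ← mul_assoc P, h2, zero_mul, mul_zero]
  abel

/-- The map `reconstruct` with values in the restricted operators. -/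
def ofPair : (H →L[ℂ] H) × HilbertSchmidt H H →L[ℂ] ResOp Hp :=
  LinearMap.mkContinuous
    { toFun := fun x => ⟨reconstruct Hp x, by
        change IsHilbertSchmidt (commProj Hp (reconstruct Hp x))
        rw [commProj_reconstruct]
        exact (offDiagonal Hp x.2).isHilbertSchmidt⟩
      map_add' := fun x y => Subtype.ext (map_add (reconstruct Hp) x y)
      map_smul' := fun c x => Subtype.ext (map_smul (reconstruct Hp) c x) }
    ‖(reconstruct Hp).prod (offDiagonal Hp ∘L ContinuousLinearMap.snd ℂ _ _)‖ fun x => by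
      refine le_trans (le_of_eq ?_) (ContinuousLinearMap.le_opNorm _ x)
      change ‖pair Hp _‖ = _
      congr 1
      exact Prod.ext rfl (Subtype.ext (commProj_reconstruct Hp x))

/-- On a compatible pair `(X, [X, P₊])` nothing is lost. Smoothness into `ResOp Hp` thus follows
from smoothness of `X` in operator norm and of its commutator in `L²`. -/
theorem toCLM_ofPair {X : H →L[ℂ] H} {K : HilbertSchmidt H H}
    (h : HilbertSchmidt.toCLM H H K = commProj Hp X) : toCLM Hp (ofPair Hp (X, K)) = X := by
  change reconstruct Hp (X, K) = X
  have hP := proj_mul_proj Hp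
  rw [reconstruct_apply, h, commProj_apply]
  set P := Hp.starProjection
  have h1 : (1 - P) * P = 0 := by rw [sub_mul, hP, one_mul, sub_self]
  have h2 : P * (1 - P) = 0 := by rw [mul_sub, hP, mul_one, sub_self]
  have e1 : (1 - P) * (X * P - P * X) * P = (1 - P) * X * P := by
    rw [mul_sub, ← mul_assoc _ P X, h1, zero_mul, sub_zero, mul_assoc, mul_assoc X P P, hP,
      mul_assoc]
  have e2 : P * (X * P - P * X) * (1 - P) = - (P * X * (1 - P)) := by
    rw [mul_sub P, sub_mul _ _ (1 - P), ← mul_assoc P X P, mul_assoc (P * X) P, h2, mul_zero,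
      ← mul_assoc P P X, hP, zero_sub]
  rw [e1, e2]
  noncomm_ring

variable {Hp} in
theorem norm_toCLM_le (X : ResOp Hp) : ‖toCLM Hp X‖ ≤ ‖X‖ := by
  change ‖(pair Hp X).1‖ ≤ ‖pair Hp X‖
  exact norm_fst_le _

/-- The inclusion into the bounded operators as a bounded map. -/
def toCLML : ResOp Hp →L[ℂ] (H →L[ℂ] H) :=
  (toCLM Hp).mkContinuous 1 fun X => by simpa using norm_toCLM_le X

@[simp]
theorem toCLML_apply (X : ResOp Hp) : toCLML Hp X = toCLM Hp X := rfl

end ResOp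

end ResOp

/-! ### Existence of smooth local sections of the restricted unitary group. -/

section LocalSections

open HilbertSchmidt

variable {H : Type*} [NormedAddCommGroup H] [InnerProductSpace ℂ H] [CompleteSpace H]
variable {Hp : Submodule ℂ H} [CompleteSpace Hp]

/-- A unitary operator that maps `H₊` onto the space of a given point of the Grassmannian. -/
theorem ResGr.exists_unitary [TopologicalSpace.SeparableSpace H]
    (hp : ¬ FiniteDimensional ℂ Hp) (hm : ¬ FiniteDimensional ℂ Hpᗮ) (W : ResGr Hp) :
    ∃ g ∈ unitary (H →L[ℂ] H), g * Hp.starProjection = (W : H →L[ℂ] H) * g := by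
  obtain ⟨e⟩ := nonempty_linearIsometryEquiv hp (ResGr.space_infinite hp W)
  obtain ⟨f⟩ := nonempty_linearIsometryEquiv hm (ResGr.space_orthogonal_infinite hm W)
  have hc1 : ∀ x : H, Hpᗮ.orthogonalProjectionOnto (Hp.orthogonalProjectionOnto x : H) = 0 :=
    fun x => by
      rw [Submodule.orthogonalProjectionOnto_eq_zero_iff, Submodule.orthogonal_orthogonal]
      exact Subtype.mem _
  have hc2 : ∀ x : H, Hp.orthogonalProjectionOnto (Hpᗮ.orthogonalProjectionOnto x : H) = 0 :=
    fun x => by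
      rw [Submodule.orthogonalProjectionOnto_eq_zero_iff]
      exact Subtype.mem _
  have hd1 : ∀ x : space W, (space W)ᗮ.orthogonalProjectionOnto (x : H) = 0 :=
    fun x => by
      rw [Submodule.orthogonalProjectionOnto_eq_zero_iff, Submodule.orthogonal_orthogonal]
      exact Subtype.mem _
  have hd2 : ∀ x : (space W)ᗮ, (space W).orthogonalProjectionOnto (x : H) = 0 :=
    fun x => by
      rw [Submodule.orthogonalProjectionOnto_eq_zero_iff]
      exact Subtype.mem _
  have h12 : extendIsometry e.symm * extendIsometry f = 0 := by
    ext x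
    simp [extendIsometry, hd2]
  have h21 : extendIsometry f.symm * extendIsometry e = 0 := by
    ext x
    simp [extendIsometry, hd1]
  have k12 : extendIsometry e * extendIsometry f.symm = 0 := by
    ext x
    change ((e (Hp.orthogonalProjectionOnto (f.symm _ : H)) : space W) : H) = 0
    rw [Submodule.orthogonalProjectionOnto_eq_zero_iff.2 (Subtype.mem _), map_zero]
    rfl
  have k21 : extendIsometry f * extendIsometry e.symm = 0 := by
    ext x
    change ((f (Hpᗮ.orthogonalProjectionOnto (e.symm _ : H)) : (space W)ᗮ) : H) = 0
    rw [Submodule.orthogonalProjectionOnto_eq_zero_iff.2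
      (by rw [Submodule.orthogonal_orthogonal]; exact Subtype.mem _), map_zero]
    rfl
  -- The direct sum of isometries `H₊ → W` and `H₋ → W^⊥`.
  refine ⟨extendIsometry e + extendIsometry f, ?_, ?_⟩
  · rw [Unitary.mem_iff, star_add, star_extendIsometry, star_extendIsometry]
    constructor
    · rw [add_mul, mul_add, mul_add, extendIsometry_symm_mul, extendIsometry_symm_mul, h12, h21,
        add_zero, zero_add, Submodule.starProjection_orthogonal', add_sub_cancel]
    · rw [add_mul, mul_add, mul_add, extendIsometry_mul_symm, extendIsometry_mul_symm, k12, k21,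
        add_zero, zero_add, Submodule.starProjection_orthogonal', add_sub_cancel]
  · rw [← extendIsometry_symm_mul e, ← starProjection_space W, ← extendIsometry_mul_symm e, add_mul,
      mul_add, ← mul_assoc (extendIsometry f), k21, zero_mul, add_zero,
      mul_assoc _ (extendIsometry e.symm) (extendIsometry f), h12, mul_zero, add_zero, mul_assoc]

theorem map_eq_space_of_intertwine {σ : H →L[ℂ] H} (hσ : σ ∈ unitary (H →L[ℂ] H)) {V : ResGr Hp}
    (h : σ * Hp.starProjection = (V : H →L[ℂ] H) * σ) :
    Hp.map σ.toLinearMap = ResGr.space V := by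
  ext y
  constructor
  · rintro ⟨x, hx, rfl⟩
    refine ⟨σ x, ?_⟩
    have := congrArg (fun A : H →L[ℂ] H => A x) h
    change σ (Hp.starProjection x) = (V : H →L[ℂ] H) (σ x) at this
    rw [Submodule.starProjection_eq_self_iff.2 hx] at this
    exact this.symm
  · rintro ⟨x, rfl⟩
    have h1 : σ (star σ x) = x :=
      congrArg (fun A : H →L[ℂ] H => A x) (Unitary.mem_iff.1 hσ).2
    refine ⟨Hp.starProjection (star σ x), Submodule.starProjection_apply_mem _ _, ?_⟩
    have := congrArg (fun A : H →L[ℂ] H => A (star σ x)) h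
    change σ (Hp.starProjection (star σ x)) = (V : H →L[ℂ] H) (σ (star σ x)) at this
    rw [h1] at this
    exact this

/-- Near a point `U` of the Grassmannian, a smooth family of unitary operators that map `U` onto
the nearby points. -/
theorem exists_smooth_rotation (U : Submodule ℂ H) [CompleteSpace U] :
    ∃ (ρ : HilbertSchmidt U Uᗮ → H →L[ℂ] H) (η : ℝ), 0 < η ∧
      ContDiffOn ℝ ∞ ρ (Metric.ball 0 η) ∧ ∀ T ∈ Metric.ball (0 : HilbertSchmidt U Uᗮ) η,
        ρ T ∈ unitary (H →L[ℂ] H) ∧ ρ T * U.starProjection = graphProj U T * ρ T := by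
  obtain ⟨r, δ, hδ, hr, hprop⟩ := exists_local_sqrt (A := H →L[ℂ] H)
  let a : HilbertSchmidt U Uᗮ → H →L[ℂ] H :=
    fun T => 1 - toCLM H H (skewHS U T) * toCLM H H (skewHS U T)
  have hskew : ContDiff ℝ ∞ fun T => toCLM H H (skewHS U T) := by
    rw [← contDiffOn_univ]
    exact (skewHS U).contDiff.contDiffOn.complex_clm (toCLML H H)
  have ha : ContDiff ℝ ∞ a := by
    rw [← contDiffOn_univ]
    exact contDiffOn_const.sub (hskew.contDiffOn.ring_mul hskew.contDiffOn)
  have ha0 : a 0 = 1 := by simp [a]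
  have hnhds : a ⁻¹' Metric.ball 1 δ ∈ nhds (0 : HilbertSchmidt U Uᗮ) :=
    ha.continuous.continuousAt.preimage_mem_nhds (by rw [ha0]; exact Metric.ball_mem_nhds _ hδ)
  obtain ⟨η, hη, hsub⟩ := Metric.mem_nhds_iff.1 hnhds
  -- The unitary polar factor `X (X* X)^(-1/2)` of `X = 1 + S`, where `X* X = 1 - S²`. Since `P_U`
  -- commutes with `S²` it commutes with the root, so the factor still carries `U` to the graph.
  refine ⟨fun T => graphShear U T * Ring.inverse (r (a T)), η, hη, ?_, fun T hT => ?_⟩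
  · refine (contDiff_graphShear U).contDiffOn.ring_mul (ContDiffOn.ringInverse ?_ fun T hT =>
      (hprop _ (hsub hT)).2.1)
    exact ((hr.restrict_scalars ℝ).of_le le_top).comp ha.contDiffOn fun T hT => hsub hT
  · obtain ⟨hsq, hu, hstar, hcomm⟩ := hprop _ (hsub hT)
    have hsa : IsSelfAdjoint (a T) := by
      change star (a T) = a T
      simp only [a, star_sub, star_one, star_mul, star_skewHS, neg_mul_neg]
    have hy : star (r (a T)) = r (a T) := hstar hsa
    have hpy := hcomm U.starProjection isStarProjection_starProjection (by
      simp only [a, mul_sub, sub_mul, mul_one, one_mul, proj_commute_skewHS_sq])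
    have hX := star_graphShear_mul T
    obtain ⟨x, hx⟩ := isUnit_graphShear T
    change star (graphShear U T) * graphShear U T = a T at hX
    obtain ⟨y, hy'⟩ := hu
    rw [← hy'] at hy hpy hsq
    rw [graphProj_eq]
    simp only [← hx, ← hy', Ring.inverse_unit] at hX ⊢
    have hyi : star (↑y⁻¹ : H →L[ℂ] H) = ↑y⁻¹ := by
      have hyu : star y = y := Units.ext hy
      rw [← Units.coe_star_inv, hyu]
    have hpyi : (↑y⁻¹ : H →L[ℂ] H) * U.starProjection = U.starProjection * ↑y⁻¹ := by
      have hc : Commute U.starProjection (y : H →L[ℂ] H) := hpy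
      exact hc.units_inv_right.eq.symm
    have hleft : star ((x : H →L[ℂ] H) * ↑y⁻¹) * (x * ↑y⁻¹) = 1 := by
      rw [star_mul, hyi, mul_assoc, ← mul_assoc (star (x : H →L[ℂ] H)), hX, ← hsq,
        mul_assoc (y : H →L[ℂ] H), Units.mul_inv, mul_one, Units.inv_mul]
    refine ⟨?_, ?_⟩
    · rw [Unitary.mem_iff]
      refine ⟨hleft, ?_⟩
      -- A left inverse of a unit is its inverse, so the isometry is unitary.
      have hunit : star ((x : H →L[ℂ] H) * ↑y⁻¹) = ↑((x * y⁻¹)⁻¹ : (H →L[ℂ] H)ˣ) :=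
        (Units.inv_eq_of_mul_eq_one_left (u := x * y⁻¹) (by simpa using hleft)).symm
      rw [hunit]
      exact Units.mul_inv (x * y⁻¹)
    · rw [mul_assoc, hpyi]
      simp only [mul_assoc, Units.inv_mul_cancel_left]

theorem ResGr.chart_self (W : ResGr Hp) : ResGr.chart W W = 0 := by
  apply toCLM_injective
  rw [ResGr.toCLM_chart, map_zero]
  have : (ResGr.space W)ᗮ.orthogonalProjectionOnto ∘L (ResGr.space W).subtypeL = 0 := by
    refine ContinuousLinearMap.ext fun x => ?_
    change (ResGr.space W)ᗮ.orthogonalProjectionOnto (x : H) = 0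
    rw [Submodule.orthogonalProjectionOnto_eq_zero_iff, Submodule.orthogonal_orthogonal]
    exact x.2
  rw [ResGr.chartOp, this, ContinuousLinearMap.zero_comp]

/-- Smooth local sections exist around every point. -/
theorem exists_localSection [TopologicalSpace.SeparableSpace H]
    (hp : ¬ FiniteDimensional ℂ Hp) (hm : ¬ FiniteDimensional ℂ Hpᗮ) (W : ResGr Hp) :
    ∃ β : LocalSection Hp, W ∈ β.dom := by
  obtain ⟨g, hg, hgW⟩ := ResGr.exists_unitary hp hm W
  obtain ⟨ρ, η, hη, hρ, hprop⟩ := exists_smooth_rotation (ResGr.space W)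
  let σ : HilbertSchmidt (ResGr.space W) (ResGr.space W)ᗮ → H →L[ℂ] H := fun T => ρ T * g
  -- The commutator of `σ` with `P₊`: since `σ P₊ = P_V σ`, it is `(P_V - P₊) σ`, where `P_V - P₊`
  -- splits as `(P_W - P₊) + (P_V - P_W)`, both in `L²`.
  let K : HilbertSchmidt (ResGr.space W) (ResGr.space W)ᗮ → HilbertSchmidt H H := fun T =>
    compRight (mk _ (ResGr.isHilbertSchmidt_sub_base W) + graphDiff (ResGr.space W) T) (σ T)
  have hσ : ContDiffOn ℝ ∞ σ (Metric.ball 0 η) := hρ.ring_mul contDiffOn_const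
  have hK : ContDiffOn ℝ ∞ K (Metric.ball 0 η) :=
    ContDiffOn.clm_apply₂ compRight
      (contDiffOn_const.add (contDiff_graphDiff (ResGr.space W)).contDiffOn) hσ
  have hunit : ∀ T ∈ Metric.ball (0 : HilbertSchmidt (ResGr.space W) (ResGr.space W)ᗮ) η,
      σ T ∈ unitary (H →L[ℂ] H) := fun T hT => mul_mem (hprop T hT).1 hg
  have hint : ∀ T ∈ Metric.ball (0 : HilbertSchmidt (ResGr.space W) (ResGr.space W)ᗮ) η,
      σ T * Hp.starProjection = (ResGr.ofGraph W T : H →L[ℂ] H) * σ T := by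
    intro T hT
    have h := (hprop T hT).2
    rw [ResGr.starProjection_space] at h
    change ρ T * g * Hp.starProjection = graphProj _ T * (ρ T * g)
    rw [mul_assoc, hgW, ← mul_assoc, h, mul_assoc]
  let Γ : HilbertSchmidt (ResGr.space W) (ResGr.space W)ᗮ → ResOp Hp :=
    fun T => ResOp.ofPair Hp (σ T, K T)
  have hΓ : ContDiffOn ℝ ∞ Γ (Metric.ball 0 η) :=
    (hσ.prodMk hK).complex_clm (ResOp.ofPair Hp)
  have hΓσ : ∀ T ∈ Metric.ball (0 : HilbertSchmidt (ResGr.space W) (ResGr.space W)ᗮ) η,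
      ResOp.toCLM Hp (Γ T) = σ T := by
    intro T hT
    apply ResOp.toCLM_ofPair
    rw [commProj_apply, hint T hT, toCLM_compRight, map_add, toCLM_mk, ← sub_mul,
      ResGr.coe_ofGraph, graphProj, ResGr.starProjection_space, add_sub_right_comm]
    rfl
  have hsub : ResGr.chartDomain W ∩ ResGr.chart W ⁻¹' Metric.ball 0 η ⊆ ResGr.chartDomain W :=
    Set.inter_subset_left
  have himage : ResGr.chart W '' (ResGr.chartDomain W ∩ ResGr.chart W ⁻¹' Metric.ball 0 η) =
      Metric.ball 0 η := by
    rw [ResGr.chart_image]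
    ext T
    simp
  have hbase : W ∈ ResGr.chartDomain W ∩ ResGr.chart W ⁻¹' Metric.ball 0 η := by
    refine ⟨ResGr.base_mem_chartDomain W, ?_⟩
    rw [Set.mem_preimage, ResGr.chart_self]
    exact Metric.mem_ball_self hη
  refine ⟨
    { base := W
      dom := ResGr.chartDomain W ∩ ResGr.chart W ⁻¹' Metric.ball 0 η
      toFun := fun V => Γ (ResGr.chart W V)
      base_mem := hbase
      dom_subset := hsub
      isOpen_dom := by rw [himage]; exact Metric.isOpen_ball
      mem_resUnitary := fun V hV => ?_
      map_eq := fun V hV => ?_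
      smooth := ⟨Γ, by rwa [himage], fun V _ => rfl⟩ }, hbase⟩
  · rw [ResUnitary, Set.mem_ofPred_eq, hΓσ _ hV.2]
    exact hunit _ hV.2
  · rw [hΓσ _ hV.2]
    have h := hint _ hV.2
    rw [ResGr.ofGraph_chart hV.1] at h
    exact map_eq_space_of_intertwine (hunit _ hV.2) h

end LocalSections

/-! ### Algebra of the Cayley transform. -/

section Cayley

variable {R : Type*} [Ring R] [StarRing R]

theorem star_unit_inv {x : Rˣ} {y : R} (h : star (x : R) = y) :
    star (↑x⁻¹ : R) * y = 1 ∧ y * star (↑x⁻¹ : R) = 1 := by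
  rw [← h, ← star_mul, ← star_mul, Units.mul_inv, Units.inv_mul, star_one]
  exact ⟨rfl, rfl⟩

/-- The Cayley transform of a unitary element is skew-adjoint. -/
theorem star_cayley {v : R} (hv : v ∈ unitary R) (hu : IsUnit (1 + v)) :
    star ((v - 1) * Ring.inverse (1 + v)) = -((v - 1) * Ring.inverse (1 + v)) := by
  obtain ⟨x, hx⟩ := hu
  obtain ⟨h1, h2⟩ := Unitary.mem_iff.1 hv
  have hs : star (x : R) = 1 + star v := by rw [hx, star_add, star_one]
  obtain ⟨k1, -⟩ := star_unit_inv hs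
  rw [← hx, Ring.inverse_unit, star_mul, star_sub, star_one]
  have e1 : (star v - 1) * x = (1 + star v) * (-(v - 1)) := by
    have a1 : (star v - 1) * (1 + v) = star v * v + star v - v - 1 := by noncomm_ring
    have a2 : (1 + star v) * (-(v - 1)) = -(star v * v) + star v - v + 1 := by noncomm_ring
    rw [hx, a1, a2, h1]
    abel
  calc star (↑x⁻¹ : R) * (star v - 1) = star (↑x⁻¹ : R) * ((star v - 1) * x) * ↑x⁻¹ := by
        simp only [mul_assoc, Units.mul_inv, mul_one]
    _ = star (↑x⁻¹ : R) * (1 + star v) * (-(v - 1)) * ↑x⁻¹ := by rw [e1]; simp only [mul_assoc]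
    _ = _ := by rw [k1, one_mul, neg_mul]

/-- The inverse Cayley transform of a skew-adjoint element is unitary. -/
theorem inverse_cayley_mem_unitary {S : R} (hS : star S = -S) (hp : IsUnit (1 + S))
    (hm : IsUnit (1 - S)) : (1 + S) * Ring.inverse (1 - S) ∈ unitary R := by
  obtain ⟨x, hx⟩ := hm
  have hs : star (x : R) = 1 + S := by rw [hx, star_sub, star_one, hS, sub_neg_eq_add]
  have hs2 : star (1 + S) = x := by rw [hx, star_add, star_one, hS, sub_eq_add_neg]
  have hcomm : (x : R) * (1 + S) = (1 + S) * x := by rw [hx]; noncomm_ring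
  obtain ⟨k1, k2⟩ := star_unit_inv hs
  rw [← hx, Ring.inverse_unit]
  have hleft : star ((1 + S) * ↑x⁻¹) * ((1 + S) * ↑x⁻¹) = 1 := by
    rw [star_mul, hs2]
    calc star (↑x⁻¹ : R) * x * ((1 + S) * ↑x⁻¹) = star (↑x⁻¹ : R) * (x * (1 + S)) * ↑x⁻¹ := by
          simp only [mul_assoc]
      _ = star (↑x⁻¹ : R) * (1 + S) * (x * ↑x⁻¹) := by rw [hcomm]; simp only [mul_assoc]
      _ = 1 := by rw [k1, Units.mul_inv, mul_one]
  obtain ⟨z, hz⟩ := hp.mul x⁻¹.isUnit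
  rw [← hz] at hleft ⊢
  refine Unitary.mem_iff.2 ⟨hleft, ?_⟩
  rw [← Units.inv_eq_of_mul_eq_one_left hleft, Units.mul_inv]

theorem inverse_cayley_cayley {v : R} (hu : IsUnit (1 + v))
    (hm : IsUnit (1 - (v - 1) * Ring.inverse (1 + v))) :
    (1 + (v - 1) * Ring.inverse (1 + v)) * Ring.inverse (1 - (v - 1) * Ring.inverse (1 + v)) =
      v := by
  have h : 1 + (v - 1) * Ring.inverse (1 + v) = v * (1 - (v - 1) * Ring.inverse (1 + v)) := by
    have h1 : (1 + v) * ((v - 1) * Ring.inverse (1 + v)) = v - 1 := by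
      have hc : (1 + v) * (v - 1) = (v - 1) * (1 + v) := by noncomm_ring
      rw [← mul_assoc, hc, mul_assoc, Ring.mul_inverse_cancel _ hu, mul_one]
    have h2 : v * (1 - (v - 1) * Ring.inverse (1 + v)) = v + (v - 1) * Ring.inverse (1 + v) -
        (1 + v) * ((v - 1) * Ring.inverse (1 + v)) := by noncomm_ring
    rw [h2, h1]
    abel
  rw [h, mul_assoc, Ring.mul_inverse_cancel _ hm, mul_one]

/-- `1 + (1 + S)(1 - S)⁻¹ = 2 (1 - S)⁻¹` is a unit, so no further condition on `S` is needed; this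
makes the Cayley charts surjective. -/
theorem cayley_inverse_cayley {S : R} (hm : IsUnit (1 - S)) (h2 : IsUnit (2 : R)) :
    IsUnit (1 + (1 + S) * Ring.inverse (1 - S)) ∧
      ((1 + S) * Ring.inverse (1 - S) - 1) * Ring.inverse (1 + (1 + S) * Ring.inverse (1 - S)) =
        S := by
  have hi := Ring.mul_inverse_cancel _ hm
  have e1 : 1 + (1 + S) * Ring.inverse (1 - S) = 2 * Ring.inverse (1 - S) := by
    nth_rw 1 [← hi]
    noncomm_ring
  have e2 : (1 + S) * Ring.inverse (1 - S) - 1 = S * (2 * Ring.inverse (1 - S)) := by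
    have h : (1 + S) * Ring.inverse (1 - S) - (1 - S) * Ring.inverse (1 - S) =
        S * (2 * Ring.inverse (1 - S)) := by noncomm_ring
    rwa [hi] at h
  have hu : IsUnit (2 * Ring.inverse (1 - S)) := h2.mul hm.ringInverse
  rw [e2, e1]
  exact ⟨hu, by rw [mul_assoc, Ring.mul_inverse_cancel _ hu, mul_one]⟩

end Cayley

/-! ### Cayley charts of the unitary group. -/

section UnitaryCharts

variable {K : Type*} [NormedAddCommGroup K] [InnerProductSpace ℂ K] [CompleteSpace K]

/-- The skew-adjoint part, as a bounded map. -/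
def skewPart : (K →L[ℂ] K) →L[ℝ] SkewOp K :=
  LinearMap.mkContinuous
    { toFun := fun X => ⟨(2⁻¹ : ℝ) • (X - star X), by
        change star _ = -_
        rw [star_smul, star_sub, star_star, star_trivial, ← smul_neg, neg_sub]⟩
      map_add' := fun X Y => Subtype.ext (by
        change (2⁻¹ : ℝ) • (X + Y - star (X + Y)) =
          (2⁻¹ : ℝ) • (X - star X) + (2⁻¹ : ℝ) • (Y - star Y)
        rw [star_add]
        module)
      map_smul' := fun c X => Subtype.ext (by
        change (2⁻¹ : ℝ) • (c • X - star (c • X)) = c • (2⁻¹ : ℝ) • (X - star X)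
        rw [star_smul, star_trivial]
        module) }
    1 fun X => by
      change ‖(2⁻¹ : ℝ) • (X - star X)‖ ≤ _
      rw [norm_smul, one_mul]
      have h := norm_sub_le X (star X)
      rw [norm_star] at h
      norm_num
      linarith

theorem coe_skewPart_of_star_eq_neg {X : K →L[ℂ] K} (h : star X = -X) :
    (skewPart X : K →L[ℂ] K) = X := by
  change (2⁻¹ : ℝ) • (X - star X) = X
  rw [h]
  module

theorem star_coe_skewOp (S : SkewOp K) : star (S : K →L[ℂ] K) = -S := S.2

instance : CompleteSpace (SkewOp K) := by
  have hcl : IsClosed ((skewAdjoint.submodule ℝ (K →L[ℂ] K) : Submodule ℝ (K →L[ℂ] K)) :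
      Set (K →L[ℂ] K)) :=
    isClosed_eq continuous_star continuous_neg
  exact hcl.completeSpace_coe

theorem isUnit_one_sub_skewOp (S : SkewOp K) : IsUnit (1 - (S : K →L[ℂ] K)) :=
  isUnit_one_sub_of_star_eq_neg (star_coe_skewOp S)

/-- The Cayley chart centred at a unitary operator. -/
def cayleyChart (u₀ : K →L[ℂ] K) (h₀ : u₀ ∈ unitary (K →L[ℂ] K)) : UnitaryChart K :=
  -- Taking the skew part gives values in the Lie algebra for every operator; on the chart domain it
  -- changes nothing.
  have hskew : ∀ u ∈ {u | IsUnit (1 + u * star u₀)} ∩ unitary (K →L[ℂ] K),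
      (skewPart ((u * star u₀ - 1) * Ring.inverse (1 + u * star u₀)) : K →L[ℂ] K) =
        (u * star u₀ - 1) * Ring.inverse (1 + u * star u₀) := fun u hu =>
    coe_skewPart_of_star_eq_neg (star_cayley (mul_mem hu.2 (Unitary.star_mem h₀)) hu.1)
  have himage : (fun u => skewPart ((u * star u₀ - 1) * Ring.inverse (1 + u * star u₀))) ''
      ({u | IsUnit (1 + u * star u₀)} ∩ unitary (K →L[ℂ] K)) = Set.univ := by
    rw [Set.eq_univ_iff_forall]
    intro S
    have hS := star_coe_skewOp S
    have h2u : IsUnit (2 : K →L[ℂ] K) := by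
      have := (IsUnit.mk0 (2 : ℂ) two_ne_zero).map (algebraMap ℂ (K →L[ℂ] K))
      rwa [map_ofNat] at this
    obtain ⟨h1, h2⟩ := cayley_inverse_cayley (isUnit_one_sub_skewOp S) h2u
    have h3 := inverse_cayley_mem_unitary hS (isUnit_one_add_of_star_eq_neg hS)
      (isUnit_one_sub_skewOp S)
    have h4 : ((1 + (S : K →L[ℂ] K)) * Ring.inverse (1 - (S : K →L[ℂ] K)) * u₀) * star u₀ =
        (1 + (S : K →L[ℂ] K)) * Ring.inverse (1 - (S : K →L[ℂ] K)) := by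
      rw [mul_assoc, (Unitary.mem_iff.1 h₀).2, mul_one]
    have hmem : (1 + (S : K →L[ℂ] K)) * Ring.inverse (1 - (S : K →L[ℂ] K)) * u₀ ∈
        {u | IsUnit (1 + u * star u₀)} ∩ (unitary (K →L[ℂ] K) : Set (K →L[ℂ] K)) := by
      refine ⟨?_, mul_mem h3 h₀⟩
      rw [Set.mem_ofPred_eq, h4]
      exact h1
    refine ⟨_, hmem, Subtype.ext ?_⟩
    rw [hskew _ hmem, h4, h2]
  { dom := {u | IsUnit (1 + u * star u₀)} ∩ unitary (K →L[ℂ] K)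
    toFun := fun u => skewPart ((u * star u₀ - 1) * Ring.inverse (1 + u * star u₀))
    isOpen_dom := ⟨_, Units.isOpen.preimage
      (continuous_const.add (continuous_id.mul continuous_const)), rfl⟩
    isOpen_image := by rw [himage]; exact isOpen_univ
    smooth := by
      have h1 : ContDiffOn ℝ ∞ (fun u : K →L[ℂ] K => u * star u₀)
          ({u | IsUnit (1 + u * star u₀)} ∩ unitary (K →L[ℂ] K)) :=
        contDiffOn_id.ring_mul contDiffOn_const
      exact skewPart.contDiff.comp_contDiffOn ((h1.sub contDiffOn_const).ring_mul
        ((contDiffOn_const.add h1).ringInverse fun u hu => hu.1))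
    smooth_inv := by
      refine ⟨fun S => (1 + (S : K →L[ℂ] K)) * Ring.inverse (1 - (S : K →L[ℂ] K)) * u₀, ?_, ?_⟩
      · have h1 : ContDiffOn ℝ ∞ (fun S : SkewOp K => (S : K →L[ℂ] K)) Set.univ :=
          (skewAdjoint.submodule ℝ (K →L[ℂ] K)).subtypeL.contDiff.contDiffOn
        rw [himage]
        exact ((contDiffOn_const.add h1).ring_mul ((contDiffOn_const.sub h1).ringInverse
          fun S _ => isUnit_one_sub_skewOp S)).ring_mul contDiffOn_const
      · intro u hu
        have h := hskew u hu
        have hm := isUnit_one_sub_skewOp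
          (skewPart ((u * star u₀ - 1) * Ring.inverse (1 + u * star u₀)))
        simp only [h] at hm ⊢
        rw [inverse_cayley_cayley hu.1 hm, mul_assoc, (Unitary.mem_iff.1 h₀).1, mul_one] }

theorem mem_cayleyChart_dom {u₀ : K →L[ℂ] K} (h₀ : u₀ ∈ unitary (K →L[ℂ] K)) :
    u₀ ∈ (cayleyChart u₀ h₀).dom := by
  refine ⟨?_, h₀⟩
  rw [Set.mem_ofPred_eq, (Unitary.mem_iff.1 h₀).2, one_add_one_eq_two]
  have := (IsUnit.mk0 (2 : ℂ) two_ne_zero).map (algebraMap ℂ (K →L[ℂ] K))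
  rwa [map_ofNat] at this

end UnitaryCharts

/-! ### Partial isometries, the corner of `H₊`, and local sections in charts. -/

section Groupoid

variable {H : Type*} [NormedAddCommGroup H] [InnerProductSpace ℂ H] [CompleteSpace H]

/-- With `p = u* u`, the difference `d = u u* u - u` satisfies `d* d = p³ - 2p² + p = 0`, so `d = 0`
by the `C*`-identity. -/
theorem IsPartialIsometry.mul_star_mul {u : H →L[ℂ] H} (hu : IsPartialIsometry u) :
    u * star u * u = u := by
  have h : star u * u * (star u * u) = star u * u := hu.isIdempotentElem.eq
  have h0 : star (u * star u * u - u) * (u * star u * u - u) = 0 := by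
    have : star (u * star u * u - u) * (u * star u * u - u) =
        star u * u * (star u * u) * (star u * u) - star u * u * (star u * u) -
          star u * u * (star u * u) + star u * u := by
      simp only [star_sub, star_mul, star_star]
      noncomm_ring
    rw [this, h, h]
    abel
  exact sub_eq_zero.1 (CStarRing.star_mul_self_eq_zero_iff _ |>.1 h0)

variable {Hp : Submodule ℂ H} [CompleteSpace Hp]

section Corner

variable (Hp) in
/-- An operator on `H₊`, extended by zero. -/
def extendOp : (Hp →L[ℂ] Hp) →L[ℂ] (H →L[ℂ] H) :=
  ContinuousLinearMap.compL ℂ H Hp H Hp.subtypeL ∘L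
    (ContinuousLinearMap.compL ℂ H Hp Hp).flip Hp.orthogonalProjectionOnto

variable (Hp) in
/-- The compression of an operator to `H₊`. -/
def compressOp : (H →L[ℂ] H) →L[ℂ] (Hp →L[ℂ] Hp) :=
  ContinuousLinearMap.compL ℂ Hp H Hp Hp.orthogonalProjectionOnto ∘L
    (ContinuousLinearMap.compL ℂ Hp H H).flip Hp.subtypeL

theorem extendOp_apply (τ : Hp →L[ℂ] Hp) :
    extendOp Hp τ = Hp.subtypeL ∘L τ ∘L Hp.orthogonalProjectionOnto := rfl

theorem compressOp_apply (x : H →L[ℂ] H) :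
    compressOp Hp x = Hp.orthogonalProjectionOnto ∘L x ∘L Hp.subtypeL := rfl

theorem extendOp_one : extendOp Hp 1 = Hp.starProjection := rfl

theorem extendOp_mul (σ τ : Hp →L[ℂ] Hp) :
    extendOp Hp (σ * τ) = extendOp Hp σ * extendOp Hp τ := by
  ext x
  simp [extendOp_apply]

theorem star_extendOp (τ : Hp →L[ℂ] Hp) : star (extendOp Hp τ) = extendOp Hp (star τ) := by
  simp only [ContinuousLinearMap.star_eq_adjoint, extendOp_apply, ContinuousLinearMap.adjoint_comp,
    Submodule.adjoint_subtypeL, Submodule.adjoint_orthogonalProjectionOnto,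
    ContinuousLinearMap.comp_assoc]

theorem compressOp_extendOp (τ : Hp →L[ℂ] Hp) : compressOp Hp (extendOp Hp τ) = τ := by
  ext x
  simp [extendOp_apply, compressOp_apply]

theorem extendOp_compressOp (x : H →L[ℂ] H) :
    extendOp Hp (compressOp Hp x) = Hp.starProjection * x * Hp.starProjection := rfl

theorem extendOp_injective : Function.Injective (extendOp Hp) :=
  Function.LeftInverse.injective compressOp_extendOp

theorem mem_unitary_iff_extendOp (τ : Hp →L[ℂ] Hp) : τ ∈ unitary (Hp →L[ℂ] Hp) ↔
    star (extendOp Hp τ) * extendOp Hp τ = Hp.starProjection ∧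
      extendOp Hp τ * star (extendOp Hp τ) = Hp.starProjection := by
  rw [star_extendOp, ← extendOp_mul, ← extendOp_mul, ← extendOp_one, extendOp_injective.eq_iff,
    extendOp_injective.eq_iff, Unitary.mem_iff]

end Corner

namespace LocalSection

variable (β β' : LocalSection Hp)

/-- The values of a local section as bounded operators. -/
def op (V : ResGr Hp) : H →L[ℂ] H := ResOp.toCLM Hp (β.toFun V)

variable {β} in
theorem op_mem_unitary {V : ResGr Hp} (hV : V ∈ β.dom) : β.op V ∈ unitary (H →L[ℂ] H) :=
  β.mem_resUnitary V hV

variable {β} in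
theorem star_op_mul {V : ResGr Hp} (hV : V ∈ β.dom) : star (β.op V) * β.op V = 1 :=
  (Unitary.mem_iff.1 (op_mem_unitary hV)).1

variable {β} in
theorem op_mul_star {V : ResGr Hp} (hV : V ∈ β.dom) : β.op V * star (β.op V) = 1 :=
  (Unitary.mem_iff.1 (op_mem_unitary hV)).2

variable {β} in
-- A unitary preserves orthogonality: it sends `P₊ x` into `V` and `x - P₊ x` into `V^⊥`.
theorem op_mul_proj {V : ResGr Hp} (hV : V ∈ β.dom) :
    β.op V * Hp.starProjection = (V : H →L[ℂ] H) * β.op V := by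
  ext x
  rw [← ResGr.starProjection_space V]
  change β.op V (Hp.starProjection x) = (ResGr.space V).starProjection (β.op V x)
  have hmap : Hp.map (β.op V).toLinearMap = ResGr.space V := β.map_eq V hV
  refine (Submodule.eq_starProjection_of_mem_orthogonal ?_ ?_).symm
  · rw [← hmap]
    exact ⟨_, Submodule.starProjection_apply_mem _ _, rfl⟩
  · rw [← hmap, Submodule.mem_orthogonal]
    rintro _ ⟨y, hy, rfl⟩
    rw [← map_sub]
    change inner ℂ (β.op V y) (β.op V (x - Hp.starProjection x)) = 0
    rw [← ContinuousLinearMap.adjoint_inner_right, ← ContinuousLinearMap.star_eq_adjoint,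
      ← mul_apply_eq_comp, star_op_mul hV]
    exact Submodule.inner_right_of_mem_orthogonal hy (Submodule.sub_starProjection_mem_orthogonal x)

variable {β} in
theorem star_op_mul_point {V : ResGr Hp} (hV : V ∈ β.dom) :
    star (β.op V) * (V : H →L[ℂ] H) = Hp.starProjection * star (β.op V) := by
  have h := congrArg star (op_mul_proj hV)
  rw [star_mul, star_mul, (ResGr.isStarProjection V).isSelfAdjoint.star_eq,
    (isSelfAdjoint_starProjection Hp).star_eq] at h
  exact h.symm

variable {β} in
theorem op_conj_proj {V : ResGr Hp} (hV : V ∈ β.dom) :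
    β.op V * Hp.starProjection * star (β.op V) = V := by
  rw [op_mul_proj hV, mul_assoc, op_mul_star hV, mul_one]

variable {β} in
theorem op_conj_point {V : ResGr Hp} (hV : V ∈ β.dom) :
    star (β.op V) * (V : H →L[ℂ] H) * β.op V = Hp.starProjection := by
  rw [star_op_mul_point hV, mul_assoc, star_op_mul hV, mul_one]

/-- The domain of a local section in the chart. -/
def image : Set (HilbertSchmidt (ResGr.space β.base) (ResGr.space β.base)ᗮ) :=
  {T | ResGr.ofGraph β.base T ∈ β.dom}

theorem chart_image_dom : ResGr.chart β.base '' β.dom = β.image :=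
  ResGr.chart_image_of_subset β.dom_subset

theorem isOpen_image : IsOpen β.image := chart_image_dom β ▸ β.isOpen_dom

variable {β} in
theorem ofGraph_chart {V : ResGr Hp} (hV : V ∈ β.dom) :
    ResGr.ofGraph β.base (ResGr.chart β.base V) = V :=
  ResGr.ofGraph_chart (β.dom_subset hV)

/-- A local section, read in the chart. -/
def opIn (T : HilbertSchmidt (ResGr.space β.base) (ResGr.space β.base)ᗮ) : H →L[ℂ] H :=
  β.op (ResGr.ofGraph β.base T)

theorem contDiffOn_opIn : ContDiffOn ℝ ∞ β.opIn β.image := by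
  obtain ⟨g, hg, hgβ⟩ := β.smooth
  rw [chart_image_dom] at hg
  refine (hg.complex_clm (ResOp.toCLML Hp)).congr fun T hT => ?_
  rw [ResOp.toCLML_apply, opIn, op, ← hgβ _ hT, ResGr.chart_ofGraph]

/-- The common domain of two local sections, in the chart of the first one. -/
def overlap : Set (HilbertSchmidt (ResGr.space β.base) (ResGr.space β.base)ᗮ) :=
  {T | ResGr.ofGraph β.base T ∈ β.dom ∩ β'.dom}

/-- Membership in the second domain is expressed through the continuous change of charts, which
gives openness. -/
theorem overlap_eq : overlap β β' = β.image ∩ (ResGr.overlap β.base β'.base ∩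
    ResGr.transition β.base β'.base ⁻¹' β'.image) := by
  ext T
  constructor
  · rintro ⟨h1, h2⟩
    refine ⟨h1, β'.dom_subset h2, ?_⟩
    change ResGr.ofGraph _ (ResGr.transition _ _ T) ∈ β'.dom
    rwa [ResGr.transition_eq, ofGraph_chart h2]
  · rintro ⟨h1, h2, h3⟩
    refine ⟨h1, ?_⟩
    change ResGr.ofGraph _ (ResGr.transition _ _ T) ∈ β'.dom at h3
    rwa [ResGr.transition_eq, ResGr.ofGraph_chart h2] at h3

theorem isOpen_overlap : IsOpen (overlap β β') := by
  rw [overlap_eq]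
  exact β.isOpen_image.inter ((ResGr.contDiffOn_transition _ _).continuousOn.isOpen_inter_preimage
    (ResGr.isOpen_overlap _ _) β'.isOpen_image)

theorem contDiffOn_transition :
    ContDiffOn ℝ ∞ (ResGr.transition β.base β'.base) (overlap β β') :=
  (ResGr.contDiffOn_transition _ _).mono fun _ hT => β'.dom_subset hT.2

/-- The second section, in the chart of the first one. -/
def opOther (T : HilbertSchmidt (ResGr.space β.base) (ResGr.space β.base)ᗮ) : H →L[ℂ] H :=
  β'.op (ResGr.ofGraph β.base T)

theorem contDiffOn_opOther : ContDiffOn ℝ ∞ (opOther β β') (overlap β β') := by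
  refine (β'.contDiffOn_opIn.comp (contDiffOn_transition β β') fun T hT => ?_).congr fun T hT => ?_
  · rw [overlap_eq] at hT
    exact hT.2.2
  · rw [Function.comp_apply, opIn, ResGr.transition_eq, ofGraph_chart hT.2]
    rfl

end LocalSection

end Groupoid

/-! ### The atlas of the groupoid. -/

section GroupoidAtlas

variable {H : Type*} [NormedAddCommGroup H] [InnerProductSpace ℂ H] [CompleteSpace H]
variable {Hp : Submodule ℂ H} [CompleteSpace Hp]

namespace URes

open LocalSection

theorem transport_eq (β γ : LocalSection Hp) (u : URes Hp) : transport β γ u =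
    compressOp Hp (star (γ.op (target u)) * u.1 * β.op (source u)) := rfl

theorem target_mul (u : URes Hp) : (target u : H →L[ℂ] H) * u.1 = u.1 :=
  IsPartialIsometry.mul_star_mul u.2.1

theorem mul_source (u : URes Hp) : u.1 * (source u : H →L[ℂ] H) = u.1 := by
  change u.1 * (star u.1 * u.1) = u.1
  rw [← mul_assoc]
  exact IsPartialIsometry.mul_star_mul u.2.1

section

variable {β γ : LocalSection Hp} {u : URes Hp}

/-- `σ_γ* u σ_β` already maps into `H₊` and vanishes on `H₋`, so compressing it to `H₊` loses
nothing. -/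
theorem extendOp_transport (hs : source u ∈ β.dom) (ht : target u ∈ γ.dom) :
    extendOp Hp (transport β γ u) = star (γ.op (target u)) * u.1 * β.op (source u) := by
  rw [transport_eq, extendOp_compressOp]
  calc Hp.starProjection * (star (γ.op (target u)) * u.1 * β.op (source u)) * Hp.starProjection
      = (Hp.starProjection * star (γ.op (target u))) * u.1 *
          (β.op (source u) * Hp.starProjection) := by simp only [mul_assoc]
    _ = star (γ.op (target u)) * ((target u : H →L[ℂ] H) * (u.1 * (source u : H →L[ℂ] H))) *
          β.op (source u) := by
        rw [← star_op_mul_point ht, op_mul_proj hs]; simp only [mul_assoc]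
    _ = _ := by rw [mul_source, target_mul]

theorem transport_mem_unitary (hs : source u ∈ β.dom) (ht : target u ∈ γ.dom) :
    transport β γ u ∈ unitary (Hp →L[ℂ] Hp) := by
  rw [mem_unitary_iff_extendOp, extendOp_transport hs ht]
  constructor
  · rw [← op_conj_point hs]
    calc star (star (γ.op (target u)) * u.1 * β.op (source u)) *
          (star (γ.op (target u)) * u.1 * β.op (source u))
        = star (β.op (source u)) * star u.1 * (γ.op (target u) * star (γ.op (target u))) * u.1 *
            β.op (source u) := by simp only [star_mul, star_star, mul_assoc]
      _ = star (β.op (source u)) * (star u.1 * u.1) * β.op (source u) := by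
        rw [op_mul_star ht, mul_one]; simp only [mul_assoc]
  · rw [← op_conj_point ht]
    calc star (γ.op (target u)) * u.1 * β.op (source u) *
          star (star (γ.op (target u)) * u.1 * β.op (source u))
        = star (γ.op (target u)) * u.1 * (β.op (source u) * star (β.op (source u))) * star u.1 *
            γ.op (target u) := by simp only [star_mul, star_star, mul_assoc]
      _ = star (γ.op (target u)) * (u.1 * star u.1) * γ.op (target u) := by
        rw [op_mul_star hs, mul_one]; simp only [mul_assoc]

end

/-- The operator with given target, source and transport. -/
def glue (σt σs : H →L[ℂ] H) (τ : Hp →L[ℂ] Hp) : H →L[ℂ] H := σt * extendOp Hp τ * star σs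

theorem glue_transport {β γ : LocalSection Hp} {u : URes Hp} (hs : source u ∈ β.dom)
    (ht : target u ∈ γ.dom) :
    glue (γ.op (target u)) (β.op (source u)) (transport β γ u) = u.1 := by
  rw [glue, extendOp_transport hs ht]
  calc γ.op (target u) * (star (γ.op (target u)) * u.1 * β.op (source u)) * star (β.op (source u))
      = (γ.op (target u) * star (γ.op (target u))) * u.1 *
          (β.op (source u) * star (β.op (source u))) := by simp only [mul_assoc]
    _ = u.1 := by rw [op_mul_star ht, op_mul_star hs, one_mul, mul_one]

/-- The glued operator has initial and final projectors `σ P₊ σ*` for the two sections, namely the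
prescribed points. -/
theorem exists_of_data {β γ : LocalSection Hp} {Vs Vt : ResGr Hp} {τ : Hp →L[ℂ] Hp}
    (hs : Vs ∈ β.dom) (ht : Vt ∈ γ.dom) (hτ : τ ∈ unitary (Hp →L[ℂ] Hp)) :
    ∃ u : URes Hp, u.1 = glue (γ.op Vt) (β.op Vs) τ ∧ source u = Vs ∧ target u = Vt ∧
      transport β γ u = τ := by
  obtain ⟨h1, h2⟩ := (mem_unitary_iff_extendOp τ).1 hτ
  have hsrc : star (glue (γ.op Vt) (β.op Vs) τ) * glue (γ.op Vt) (β.op Vs) τ = Vs := by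
    calc star (glue (γ.op Vt) (β.op Vs) τ) * glue (γ.op Vt) (β.op Vs) τ
        = β.op Vs * star (extendOp Hp τ) * (star (γ.op Vt) * γ.op Vt) * extendOp Hp τ *
            star (β.op Vs) := by simp only [glue, star_mul, star_star, mul_assoc]
      _ = β.op Vs * (star (extendOp Hp τ) * extendOp Hp τ) * star (β.op Vs) := by
        rw [star_op_mul ht, mul_one]; simp only [mul_assoc]
      _ = Vs := by rw [h1, op_conj_proj hs]
  have htgt : glue (γ.op Vt) (β.op Vs) τ * star (glue (γ.op Vt) (β.op Vs) τ) = Vt := by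
    calc glue (γ.op Vt) (β.op Vs) τ * star (glue (γ.op Vt) (β.op Vs) τ)
        = γ.op Vt * extendOp Hp τ * (star (β.op Vs) * β.op Vs) * star (extendOp Hp τ) *
            star (γ.op Vt) := by simp only [glue, star_mul, star_star, mul_assoc]
      _ = γ.op Vt * (extendOp Hp τ * star (extendOp Hp τ)) * star (γ.op Vt) := by
        rw [star_op_mul hs, mul_one]; simp only [mul_assoc]
      _ = Vt := by rw [h2, op_conj_proj ht]
  let u : URes Hp := ⟨glue (γ.op Vt) (β.op Vs) τ, by
    refine ⟨?_, ?_, ?_⟩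
    · rw [IsPartialIsometry, hsrc]
      exact ResGr.isStarProjection Vs
    · rw [hsrc]; exact Vs.2
    · rw [htgt]; exact Vt.2⟩
  have hus : source u = Vs := Subtype.ext hsrc
  have hut : target u = Vt := Subtype.ext htgt
  refine ⟨u, rfl, hus, hut, ?_⟩
  apply extendOp_injective
  rw [extendOp_transport (hus ▸ hs) (hut ▸ ht), hus, hut]
  calc star (γ.op Vt) * (γ.op Vt * extendOp Hp τ * star (β.op Vs)) * β.op Vs
      = (star (γ.op Vt) * γ.op Vt) * extendOp Hp τ * (star (β.op Vs) * β.op Vs) := by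
        simp only [mul_assoc]
    _ = extendOp Hp τ := by rw [star_op_mul ht, star_op_mul hs, one_mul, mul_one]

end URes

namespace UnitaryChart

variable {K : Type*} [NormedAddCommGroup K] [InnerProductSpace ℂ K] [CompleteSpace K]

/-- A smooth inverse of a chart of the unitary group. -/
def inv (α : UnitaryChart K) : SkewOp K → (K →L[ℂ] K) := α.smooth_inv.choose

theorem contDiffOn_inv (α : UnitaryChart K) : ContDiffOn ℝ ∞ α.inv (α.toFun '' α.dom) :=
  α.smooth_inv.choose_spec.1

theorem inv_toFun (α : UnitaryChart K) {u : K →L[ℂ] K} (hu : u ∈ α.dom) :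
    α.inv (α.toFun u) = u :=
  α.smooth_inv.choose_spec.2 u hu

theorem inv_mem {α : UnitaryChart K} {c : SkewOp K} (hc : c ∈ α.toFun '' α.dom) :
    α.inv c ∈ α.dom := by
  obtain ⟨u, hu, rfl⟩ := hc
  rwa [inv_toFun α hu]

theorem toFun_inv {α : UnitaryChart K} {c : SkewOp K} (hc : c ∈ α.toFun '' α.dom) :
    α.toFun (α.inv c) = c := by
  obtain ⟨u, hu, rfl⟩ := hc
  rw [inv_toFun α hu]

theorem dom_subset_unitary (α : UnitaryChart K) : α.dom ⊆ unitary (K →L[ℂ] K) := by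
  obtain ⟨O, -, h⟩ := α.isOpen_dom
  rw [h]
  exact Set.inter_subset_right

end UnitaryChart

namespace URes

open LocalSection

/-- The element of the groupoid with given coordinates, as a bounded operator. -/
def ofCoord (i : ChartIndex Hp) (x : Model i) : H →L[ℂ] H :=
  glue (i.γ.opIn x.1) (i.β.opIn x.2.1) (i.α.inv x.2.2)

/-- The image of the domain of a chart. -/
def image (i : ChartIndex Hp) : Set (Model i) :=
  i.γ.image ×ˢ i.β.image ×ˢ (i.α.toFun '' i.α.dom)

theorem isOpen_image (i : ChartIndex Hp) : IsOpen (image i) :=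
  i.γ.isOpen_image.prod (i.β.isOpen_image.prod i.α.isOpen_image)

theorem chart_mem_image {i : ChartIndex Hp} {u : URes Hp} (hu : u ∈ chartDomain i) :
    chart i u ∈ image i := by
  refine ⟨?_, ?_, ⟨_, hu.2.2, rfl⟩⟩
  · change ResGr.ofGraph _ _ ∈ i.γ.dom
    rw [chart, LocalSection.ofGraph_chart hu.2.1]
    exact hu.2.1
  · change ResGr.ofGraph _ _ ∈ i.β.dom
    rw [chart, LocalSection.ofGraph_chart hu.1]
    exact hu.1

theorem ofCoord_chart {i : ChartIndex Hp} {u : URes Hp} (hu : u ∈ chartDomain i) :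
    ofCoord i (chart i u) = u.1 := by
  rw [ofCoord, chart, opIn, opIn, LocalSection.ofGraph_chart hu.2.1,
    LocalSection.ofGraph_chart hu.1, UnitaryChart.inv_toFun _ hu.2.2, glue_transport hu.1 hu.2.1]

theorem exists_of_mem_image {i : ChartIndex Hp} {x : Model i} (hx : x ∈ image i) :
    ∃ u ∈ chartDomain i, chart i u = x ∧ u.1 = ofCoord i x ∧
      source u = ResGr.ofGraph i.β.base x.2.1 ∧ target u = ResGr.ofGraph i.γ.base x.1 := by
  obtain ⟨a, b, c⟩ := x
  obtain ⟨ha, hb, hc⟩ := hx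
  obtain ⟨u, hu, hs, ht, hτ⟩ := exists_of_data (β := i.β) (γ := i.γ) hb ha
    (i.α.dom_subset_unitary (UnitaryChart.inv_mem hc))
  refine ⟨u, ⟨?_, ?_, ?_⟩, ?_, hu, hs, ht⟩
  · rw [hs]; exact hb
  · rw [ht]; exact ha
  · rw [hτ]; exact UnitaryChart.inv_mem hc
  · rw [chart, hs, ht, hτ, ResGr.chart_ofGraph, ResGr.chart_ofGraph, UnitaryChart.toFun_inv hc]

theorem contDiffOn_ofCoord (i : ChartIndex Hp) : ContDiffOn ℝ ∞ (ofCoord i) (image i) := by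
  have h1 : ContDiffOn ℝ ∞ (fun x : Model i => i.γ.opIn x.1) (image i) :=
    i.γ.contDiffOn_opIn.comp contDiff_fst.contDiffOn fun x hx => hx.1
  have h2 : ContDiffOn ℝ ∞ (fun x : Model i => i.β.opIn x.2.1) (image i) :=
    i.β.contDiffOn_opIn.comp (contDiff_fst.comp contDiff_snd).contDiffOn fun x hx => hx.2.1
  have h3 : ContDiffOn ℝ ∞ (fun x : Model i => i.α.inv x.2.2) (image i) :=
    i.α.contDiffOn_inv.comp (contDiff_snd.comp contDiff_snd).contDiffOn fun x hx => hx.2.2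
  have h4 : ContDiffOn ℝ ∞ (fun x : Model i => star (i.β.opIn x.2.1)) (image i) :=
    (starL' ℝ : (H →L[ℂ] H) ≃L[ℝ] (H →L[ℂ] H)).contDiff.comp_contDiffOn h2
  have h5 : ContDiffOn ℝ ∞ (fun x : Model i => extendOp Hp (i.α.inv x.2.2)) (image i) :=
    h3.complex_clm (extendOp Hp)
  have h6 : ContDiffOn ℝ ∞ (fun x : Model i => i.γ.opIn x.1 * extendOp Hp (i.α.inv x.2.2))
      (image i) := h1.ring_mul h5
  exact h6.ring_mul h4

/-- The common domain of two charts, in the coordinates of the first one, up to the condition on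
the chart of the unitary group. -/
def preOverlap (i j : ChartIndex Hp) : Set (Model i) :=
  (i.γ.overlap j.γ) ×ˢ (i.β.overlap j.β) ×ˢ (i.α.toFun '' i.α.dom)

theorem preOverlap_subset (i j : ChartIndex Hp) : preOverlap i j ⊆ image i :=
  fun _ hx => ⟨hx.1.1, hx.2.1.1, hx.2.2⟩

theorem isOpen_preOverlap (i j : ChartIndex Hp) : IsOpen (preOverlap i j) :=
  (LocalSection.isOpen_overlap _ _).prod ((LocalSection.isOpen_overlap _ _).prod
    i.α.isOpen_image)

/-- The transport of the second chart in the coordinates of the first one. -/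
def otherTransport (i j : ChartIndex Hp) (x : Model i) : Hp →L[ℂ] Hp :=
  compressOp Hp (star (opOther i.γ j.γ x.1) * ofCoord i x * opOther i.β j.β x.2.1)

theorem contDiffOn_otherTransport (i j : ChartIndex Hp) :
    ContDiffOn ℝ ∞ (otherTransport i j) (preOverlap i j) := by
  have h1 : ContDiffOn ℝ ∞ (fun x : Model i => opOther i.γ j.γ x.1) (preOverlap i j) :=
    (contDiffOn_opOther i.γ j.γ).comp contDiff_fst.contDiffOn fun x hx => hx.1
  have h2 : ContDiffOn ℝ ∞ (fun x : Model i => opOther i.β j.β x.2.1) (preOverlap i j) :=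
    (contDiffOn_opOther i.β j.β).comp (contDiff_fst.comp contDiff_snd).contDiffOn
      fun x hx => hx.2.1
  have h3 : ContDiffOn ℝ ∞ (fun x : Model i => star (opOther i.γ j.γ x.1)) (preOverlap i j) :=
    (starL' ℝ : (H →L[ℂ] H) ≃L[ℝ] (H →L[ℂ] H)).contDiff.comp_contDiffOn h1
  have h4 : ContDiffOn ℝ ∞ (ofCoord i) (preOverlap i j) :=
    (contDiffOn_ofCoord i).mono (preOverlap_subset i j)
  have h5 : ContDiffOn ℝ ∞ (fun x : Model i => star (opOther i.γ j.γ x.1) * ofCoord i x)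
      (preOverlap i j) := h3.ring_mul h4
  have h6 : ContDiffOn ℝ ∞ (fun x : Model i => star (opOther i.γ j.γ x.1) * ofCoord i x *
      opOther i.β j.β x.2.1) (preOverlap i j) := h5.ring_mul h2
  exact ContDiffOn.complex_clm (Y := Hp →L[ℂ] Hp) (compressOp Hp) h6

theorem otherTransport_chart {i j : ChartIndex Hp} {u : URes Hp} (hi : u ∈ chartDomain i) :
    otherTransport i j (chart i u) = transport j.β j.γ u := by
  rw [otherTransport, ofCoord_chart hi, transport_eq, chart, opOther, opOther,
    LocalSection.ofGraph_chart hi.2.1, LocalSection.ofGraph_chart hi.1]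

theorem chart_image_inter (i j : ChartIndex Hp) :
    chart i '' (chartDomain i ∩ chartDomain j) =
      preOverlap i j ∩ otherTransport i j ⁻¹' j.α.dom := by
  ext x
  constructor
  · rintro ⟨u, ⟨hi, hj⟩, rfl⟩
    have hx := chart_mem_image hi
    refine ⟨⟨⟨hx.1, ?_⟩, ⟨hx.2.1, ?_⟩, hx.2.2⟩, ?_⟩
    · rw [chart, LocalSection.ofGraph_chart hi.2.1]
      exact hj.2.1
    · rw [chart, LocalSection.ofGraph_chart hi.1]
      exact hj.1
    · rw [Set.mem_preimage, otherTransport_chart hi]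
      exact hj.2.2
  · rintro ⟨hx, hτ⟩
    obtain ⟨u, hi, rfl, -, hs, ht⟩ := exists_of_mem_image (preOverlap_subset i j hx)
    rw [Set.mem_preimage, otherTransport_chart hi] at hτ
    refine ⟨u, ⟨hi, ?_, ?_, hτ⟩, rfl⟩
    · rw [hs]; exact hx.2.1.2
    · rw [ht]; exact hx.1.2

theorem chart_image (i : ChartIndex Hp) : chart i '' chartDomain i = image i := by
  ext x
  constructor
  · rintro ⟨u, hu, rfl⟩
    exact chart_mem_image hu
  · intro hx
    obtain ⟨u, hu, h, -⟩ := exists_of_mem_image hx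
    exact ⟨u, hu, h⟩

/-- A chart domain of the unitary group is only relatively open. On `preOverlap` the second
transport is automatically unitary, so the condition can be tested on an open set of bounded
operators. -/
theorem isOpen_chart_image_inter (i j : ChartIndex Hp) :
    IsOpen (chart i '' (chartDomain i ∩ chartDomain j)) := by
  obtain ⟨O, hO, hdom⟩ := j.α.isOpen_dom
  have : chart i '' (chartDomain i ∩ chartDomain j) =
      preOverlap i j ∩ otherTransport i j ⁻¹' O := by
    rw [chart_image_inter]
    ext x
    refine ⟨fun hx => ⟨hx.1, ?_⟩, fun hx => ⟨hx.1, ?_⟩⟩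
    · have := hx.2
      rw [Set.mem_preimage, hdom] at this
      exact this.1
    · obtain ⟨u, hi, hux, -, hs, ht⟩ := exists_of_mem_image (preOverlap_subset i j hx.1)
      rw [Set.mem_preimage, hdom]
      refine ⟨hx.2, ?_⟩
      rw [← hux, otherTransport_chart hi]
      exact transport_mem_unitary (by rw [hs]; exact hx.1.2.1.2) (by rw [ht]; exact hx.1.1.2)
  rw [this]
  exact (contDiffOn_otherTransport i j).continuousOn.isOpen_inter_preimage
    (isOpen_preOverlap i j) hO

theorem exists_smooth_transition (i j : ChartIndex Hp) : ∃ g : Model i → Model j,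
    ContDiffOn ℝ ∞ g (chart i '' (chartDomain i ∩ chartDomain j)) ∧
      ∀ u ∈ chartDomain i ∩ chartDomain j, g (chart i u) = chart j u := by
  refine ⟨fun x => (ResGr.transition i.γ.base j.γ.base x.1,
    ResGr.transition i.β.base j.β.base x.2.1, j.α.toFun (otherTransport i j x)), ?_, ?_⟩
  · rw [chart_image_inter]
    refine ContDiffOn.prodMk ?_ (ContDiffOn.prodMk ?_ ?_)
    · exact (LocalSection.contDiffOn_transition i.γ j.γ).comp contDiff_fst.contDiffOn
        fun x hx => hx.1.1
    · exact (LocalSection.contDiffOn_transition i.β j.β).comp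
        (contDiff_fst.comp contDiff_snd).contDiffOn fun x hx => hx.1.2.1
    · exact j.α.smooth.comp ((contDiffOn_otherTransport i j).mono Set.inter_subset_left)
        fun x hx => hx.2
  · rintro u ⟨hi, hj⟩
    simp only [otherTransport_chart hi]
    rw [chart, chart, ResGr.transition_eq, ResGr.transition_eq,
      LocalSection.ofGraph_chart hi.2.1, LocalSection.ofGraph_chart hi.1]

set_option synthInstance.maxHeartbeats 200000 in
/-- The groupoid is a smooth Hausdorff Banach manifold. -/
theorem isBanachManifoldAtlas [TopologicalSpace.SeparableSpace H]
    (hp : ¬ FiniteDimensional ℂ Hp) (hm : ¬ FiniteDimensional ℂ Hpᗮ) :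
    IsBanachManifoldAtlas (chartDomain (Hp := Hp)) chart := by
  have hcover : ∀ u : URes Hp, ∃ i, u ∈ chartDomain i := by
    intro u
    obtain ⟨β, hβ⟩ := exists_localSection hp hm (source u)
    obtain ⟨γ, hγ⟩ := exists_localSection hp hm (target u)
    exact ⟨⟨cayleyChart _ (transport_mem_unitary hβ hγ), β, γ⟩, hβ, hγ, 
      mem_cayleyChart_dom (transport_mem_unitary hβ hγ)⟩
  refine IsBanachManifoldAtlas.mk ?_ ?_ ?_ ?_ ?_ ?_
  · exact fun i => inferInstance
  · exact hcover
  · intro i u hu v hv h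
    apply Subtype.ext
    rw [← ofCoord_chart hu, h, ofCoord_chart hv]
  · exact isOpen_chart_image_inter
  · exact exists_smooth_transition
  · refine t2Space_atlasTopology hcover (f := fun u : URes Hp => u.1)
      Subtype.val_injective fun i => ?_
    rw [chart_image]
    exact ⟨isOpen_image i, ofCoord i, (contDiffOn_ofCoord i).continuousOn,
      fun u hu => ofCoord_chart hu⟩

end URes

end GroupoidAtlas

/-! ### Restriction of scalars and the final assembly. -/

section RealRestrict

variable {X Y : Type*} [NormedAddCommGroup X] [NormedSpace ℂ X] [NormedAddCommGroup Y]
  [NormedSpace ℂ Y]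

/-- A complex isomorphism as a real isomorphism. -/
def ContinuousLinearEquiv.realRestrict (e : X ≃L[ℂ] Y) : X ≃L[ℝ] Y :=
  { e.toLinearEquiv.restrictScalars ℝ with
    continuous_toFun := e.continuous
    continuous_invFun := e.symm.continuous }

end RealRestrict

end

theorem mainTheorem3 {H : Type*} [NormedAddCommGroup H] [InnerProductSpace ℂ H] [CompleteSpace H]
    [TopologicalSpace.SeparableSpace H] (Hp : Submodule ℂ H) [CompleteSpace Hp]
    (hp : ¬ FiniteDimensional ℂ Hp) (hm : ¬ FiniteDimensional ℂ Hpᗮ) :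
    -- transitive
    Function.Surjective (fun u : URes Hp => (URes.source u, URes.target u)) ∧
    -- the base is a Banach manifold, with model spaces isomorphic to `L²(H₊, H₋)`
    ((∀ W : ResGr Hp, ∀ V ∈ ResGr.chartDomain W, IsHilbertSchmidt (ResGr.chartOp W V)) ∧
      IsBanachManifoldAtlas (ResGr.chartDomain (Hp := Hp)) ResGr.chart ∧
      ∀ W : ResGr Hp, Nonempty
        (HilbertSchmidt (ResGr.space W) (ResGr.space W)ᗮ ≃L[ℂ] HilbertSchmidt Hp Hpᗮ)) ∧
    -- the total space is a Banach manifold, with model spaces isomorphic to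
    -- `L²(H₊, H₋) × L²(H₊, H₋) × 𝔲₊`
    (IsBanachManifoldAtlas (URes.chartDomain (Hp := Hp)) URes.chart ∧
      ∀ i : URes.ChartIndex Hp, Nonempty
        (URes.Model i ≃L[ℝ] HilbertSchmidt Hp Hpᗮ × HilbertSchmidt Hp Hpᗮ × SkewOp Hp)) := by
  refine ⟨URes.source_target_surjective hp,
    ⟨fun W V _ => ResGr.isHilbertSchmidt_chartOp W V, ResGr.isBanachManifoldAtlas,
      ResGr.nonempty_model_equiv hp hm⟩,
    URes.isBanachManifoldAtlas hp hm, fun i => ?_⟩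
  obtain ⟨e⟩ := ResGr.nonempty_model_equiv hp hm i.γ.base
  obtain ⟨f⟩ := ResGr.nonempty_model_equiv hp hm i.β.base
  let e' : HilbertSchmidt (ResGr.space i.γ.base) (ResGr.space i.γ.base)ᗮ ≃L[ℝ]
      HilbertSchmidt Hp Hpᗮ :=
    e.realRestrict
  let f' : HilbertSchmidt (ResGr.space i.β.base) (ResGr.space i.β.base)ᗮ ≃L[ℝ]
      HilbertSchmidt Hp Hpᗮ :=
    f.realRestrict
  exact ⟨e'.prodCongr (f'.prodCongr (ContinuousLinearEquiv.refl ℝ (SkewOp Hp)))⟩
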